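/- Let $N\ge 1$ be an integer, let $\hbar$ be a nonzero complex number, and fix a label $(\gamma_{N1},\dots,\gamma_{NN})\in\mathbb{C}^N$. Let $M$ be the complex vector space of meromorphic functions on $\mathbb{C}^{N(N-1)/2}$ in the variables $\gamma_{nj}$, $1\le j\le n\le N-1$. For $c\in\mathbb{C}$ let $e^{c\,\partial_{\gamma_{nj}}}$ denote the shift operator replacing $\gamma_{nj}$ by $\gamma_{nj}+c$ and leaving the other variables unchanged. Consider the operators on $M$ $$E_{nn}=\frac{1}{i\hbar}\Big(\sum_{j=1}^{n}\gamma_{nj}-\sum_{j=1}^{n-1}\gamma_{n-1,j}\Big),\qquad n=1,\dots,N,$$ $$E_{n,n+1}=-\frac{1}{i\hbar}\sum_{j=1}^{n}\frac{\prod_{r=1}^{n+1}\big(\gamma_{nj}-\gamma_{n+1,r}-\frac{i\hbar}{2}\big)}{\prod_{s\ne j}(\gamma_{nj}-\gamma_{ns})}\,e^{-i\hbar\,\partial_{\gamma_{nj}}},\qquad n=1,\dots,N-1,$$ $$E_{n+1,n}=\frac{1}{i\hbar}\sum_{j=1}^{n}\frac{\prod_{r=1}^{n-1}\big(\gamma_{nj}-\gamma_{n-1,r}+\frac{i\hbar}{2}\big)}{\prod_{s\ne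 j}(\gamma_{nj}-\gamma_{ns})}\,e^{i\hbar\,\partial_{\gamma_{nj}}},\qquad n=1,\dots,N-1,$$ where $s$ runs over $\{1,\dots,n\}\setminus\{j\}$. These operators map $M$ to $M$ and form a representation of $\mathfrak{gl}(N)$ in $M$: there is one and only one homomorphism of complex Lie algebras $\rho:\mathfrak{gl}(N,\mathbb{C})\to\operatorname{End}_{\mathbb{C}}(M)$ that sends the matrix units with indices $(n,n)$, $(n,n+1)$ and $(n+1,n)$ to the operators $E_{nn}$, $E_{n,n+1}$ and $E_{n+1,n}$, respectively. -/

import Mathlib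

open scoped Topology

-- Matrices and endomorphisms are Lie algebras for the commutator.
attribute [local instance] LieRing.ofAssociativeRing

/-- A function `f` on a finite-dimensional complex space is meromorphic if near every point it is
a quotient `g / h` of holomorphic functions with `h` not identically zero near the point
(no condition is put on the values of `f` on the zero set of `h`). -/
def IsMeromorphic {X : Type*} [NormedAddCommGroup X] [NormedSpace ℂ X] (f : X → ℂ) : Prop :=
  ∀ p : X, ∃ g h : X → ℂ, AnalyticAt ℂ g p ∧ AnalyticAt ℂ h p ∧ (¬ ∀ᶠ z in 𝓝 p, h z = 0) ∧
    ∀ᶠ z in 𝓝 p, h z ≠ 0 → f z = g z / h z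

/-- The filter of the sets that contain a dense open set. -/
def denseOpenFilter (X : Type*) [TopologicalSpace X] : Filter X where
  sets := {s | Dense (interior s)}
  univ_sets := by simp
  sets_of_superset := fun hs hst => hs.mono (interior_mono hst)
  inter_sets := fun {s t} hs ht => by
    change Dense (interior (s ∩ t))
    rw [interior_inter]
    exact Dense.inter_of_isOpen_left hs ht isOpen_interior

/-- The germs along the dense open sets: functions up to equality on a dense open set. -/
abbrev GenericFun (X : Type*) [TopologicalSpace X] : Type _ :=
  Filter.Germ (denseOpenFilter X) ℂ

theorem not_eventually_mul_eq_zero {X : Type*} [NormedAddCommGroup X] [NormedSpace ℂ X]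
    {h₁ h₂ : X → ℂ} {p : X} (a₁ : AnalyticAt ℂ h₁ p) (a₂ : AnalyticAt ℂ h₂ p)
    (n₁ : ¬ ∀ᶠ z in 𝓝 p, h₁ z = 0) (n₂ : ¬ ∀ᶠ z in 𝓝 p, h₂ z = 0) :
    ¬ ∀ᶠ z in 𝓝 p, h₁ z * h₂ z = 0 := by
  intro h0
  obtain ⟨r, hr, hb⟩ := Metric.eventually_nhds_iff_ball.1
    (h0.and (a₁.eventually_analyticAt.and a₂.eventually_analyticAt))
  have hpre : IsPreconnected (Metric.ball p r) := (convex_ball p r).isPreconnected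
  have hmem : Metric.ball p r ∈ 𝓝 p := Metric.ball_mem_nhds p hr
  have hex : ∃ q ∈ Metric.ball p r, h₁ q ≠ 0 := by
    by_contra hc
    push Not at hc
    exact n₁ (Filter.mem_of_superset hmem hc)
  obtain ⟨q, hq, hq1⟩ := hex
  have hev : h₂ =ᶠ[𝓝 q] 0 := by
    filter_upwards [(hb q hq).2.1.continuousAt.eventually_ne hq1,
      Metric.isOpen_ball.mem_nhds hq] with z hz hzb
    exact (mul_eq_zero.1 (hb z hzb).1).resolve_left hz
  have han : AnalyticOnNhd ℂ h₂ (Metric.ball p r) := fun z hz => (hb z hz).2.2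
  have := han.eqOn_zero_of_preconnected_of_eventuallyEq_zero hpre hq hev
  exact n₂ (Filter.mem_of_superset hmem this)

theorem IsMeromorphic.add {X : Type*} [NormedAddCommGroup X] [NormedSpace ℂ X] {f₁ f₂ : X → ℂ}
    (m₁ : IsMeromorphic f₁) (m₂ : IsMeromorphic f₂) : IsMeromorphic (f₁ + f₂) := by
  intro p
  obtain ⟨g₁, h₁, ag₁, ah₁, n₁, e₁⟩ := m₁ p
  obtain ⟨g₂, h₂, ag₂, ah₂, n₂, e₂⟩ := m₂ p
  refine ⟨fun z => g₁ z * h₂ z + h₁ z * g₂ z, fun z => h₁ z * h₂ z,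
    (ag₁.mul ah₂).add (ah₁.mul ag₂), ah₁.mul ah₂, not_eventually_mul_eq_zero ah₁ ah₂ n₁ n₂, ?_⟩
  filter_upwards [e₁, e₂] with z hz₁ hz₂ hz
  obtain ⟨k₁, k₂⟩ := mul_ne_zero_iff.1 hz
  rw [Pi.add_apply, hz₁ k₁, hz₂ k₂, div_add_div _ _ k₁ k₂]

theorem IsMeromorphic.const_smul {X : Type*} [NormedAddCommGroup X] [NormedSpace ℂ X] {f : X → ℂ}
    (c : ℂ) (m : IsMeromorphic f) : IsMeromorphic (c • f) := by
  intro p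
  obtain ⟨g, h, ag, ah, n, e⟩ := m p
  refine ⟨fun z => c * g z, h, analyticAt_const.mul ag, ah, n, ?_⟩
  filter_upwards [e] with z hz hz0
  rw [Pi.smul_apply, smul_eq_mul, hz hz0, mul_div_assoc]

/-- The complex vector space of meromorphic functions on `X`: two of them are identified if they
agree on a dense open set. -/
def MeromorphicSpace (X : Type*) [NormedAddCommGroup X] [NormedSpace ℂ X] :
    Submodule ℂ (GenericFun X) where
  carrier := {F | ∃ f : X → ℂ, IsMeromorphic f ∧ (f : GenericFun X) = F}
  zero_mem' := ⟨0, fun _ => ⟨0, 1, analyticAt_const, analyticAt_const,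
    by simp [Filter.NeBot.ne], by simp⟩, rfl⟩
  add_mem' := by
    rintro _ _ ⟨f₁, m₁, rfl⟩ ⟨f₂, m₂, rfl⟩
    exact ⟨f₁ + f₂, m₁.add m₂, rfl⟩
  smul_mem' := by
    rintro c _ ⟨f, m, rfl⟩
    exact ⟨c • f, m.const_smul c, rfl⟩

/-- The element of `MeromorphicSpace X` given by a meromorphic function. -/
def IsMeromorphic.toSpace {X : Type*} [NormedAddCommGroup X] [NormedSpace ℂ X] {f : X → ℂ}
    (hf : IsMeromorphic f) : MeromorphicSpace X :=
  ⟨(f : GenericFun X), f, hf, rfl⟩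

/-- The space `ℂ ^ (N (N - 1) / 2)` of triangular arrays `γ n j`, where `n < N` is the row and
`j : Fin n` the place in the row (so the row `n` has `n` entries, and the row `0` is empty). -/
abbrev GZArray (N : ℕ) : Type :=
  (Σ n : Fin N, Fin (n : ℕ)) → ℂ

/-- The entry `γ n j` for `n ≤ N`; the last row, `n = N`, is the fixed label. -/
def gzEntry {N : ℕ} (label : Fin N → ℂ) (γ : GZArray N) (n : ℕ) (hn : n ≤ N) (j : Fin n) : ℂ :=
  if h : n < N then γ ⟨⟨n, h⟩, j⟩ else label (Fin.castLE hn j)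

/-- The shift `exp (c ∂ / ∂ γ n j)`, that is, `f (γ) ↦ f (γ + c e)` with `e` the basis vector of
the variable `γ n j`. -/
def gzShift {N : ℕ} (n : ℕ) (hn : n < N) (j : Fin n) (c : ℂ) (f : GZArray N → ℂ) :
    GZArray N → ℂ :=
  fun γ => f (γ + Pi.single ⟨⟨n, hn⟩, j⟩ c)

/-- The operator `E n n` for `n = k + 1`, `1 ≤ n ≤ N`. -/
noncomputable def gzDiag {N : ℕ} (hbar : ℂ) (label : Fin N → ℂ) (k : ℕ) (hk : k + 1 ≤ N)
    (f : GZArray N → ℂ) : GZArray N → ℂ :=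
  fun γ => 1 / (Complex.I * hbar) *
    (∑ j : Fin (k + 1), gzEntry label γ (k + 1) hk j -
      ∑ j : Fin k, gzEntry label γ k (Nat.le_of_succ_le hk) j) * f γ

/-- The operator `E n (n + 1)` for `n = k + 1`, `1 ≤ n ≤ N - 1`. -/
noncomputable def gzRaise {N : ℕ} (hbar : ℂ) (label : Fin N → ℂ) (k : ℕ) (hk : k + 1 < N)
    (f : GZArray N → ℂ) : GZArray N → ℂ :=
  fun γ => -(1 / (Complex.I * hbar)) * ∑ j : Fin (k + 1),
    (∏ r : Fin (k + 2), (gzEntry label γ (k + 1) hk.le j - gzEntry label γ (k + 2) hk r -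
        Complex.I * hbar / 2)) /
      (∏ s ∈ Finset.univ.erase j,
        (gzEntry label γ (k + 1) hk.le j - gzEntry label γ (k + 1) hk.le s)) *
      gzShift (k + 1) hk j (-(Complex.I * hbar)) f γ

/-- The operator `E (n + 1) n` for `n = k + 1`, `1 ≤ n ≤ N - 1`. -/
noncomputable def gzLower {N : ℕ} (hbar : ℂ) (label : Fin N → ℂ) (k : ℕ) (hk : k + 1 < N)
    (f : GZArray N → ℂ) : GZArray N → ℂ :=
  fun γ => 1 / (Complex.I * hbar) * ∑ j : Fin (k + 1),
    (∏ r : Fin k, (gzEntry label γ (k + 1) hk.le j - gzEntry label γ k (Nat.le_of_succ_le hk.le) r +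
        Complex.I * hbar / 2)) /
      (∏ s ∈ Finset.univ.erase j,
        (gzEntry label γ (k + 1) hk.le j - gzEntry label γ (k + 1) hk.le s)) *
      gzShift (k + 1) hk j (Complex.I * hbar) f γ

/-! A linear map out of gl(N) that respects brackets with a set of Lie generators respects all
brackets. So existence amounts to the Serre relations for the given operators
(`isChevalleySystem_gz`): the images of the other matrix units are forced to be iterated brackets of
the generators, and `lie_h_unit`, `lie_e_unit`, `lie_f_unit` show that the generators act on these
brackets as they do on matrix units, whence `IsChevalleySystem.map_lie`. Uniqueness rests on the
same generation statement, `lieSubalgebra_eq_top_of_single_mem`, applied to the subalgebra on which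
two homomorphisms agree.

Up to scalars, E_{n,n+1} and E_{n+1,n} are instances of one operator `rowOp`: row n is coupled to
row n+1 with d = iℏ, or to row n-1 with d = -iℏ. Each relation is therefore proved once for abstract
rows x, y, z. In the Serre relations (`rowOp_serre_left`, `rowOp_serre_right`) the coefficient of a
fixed composite shift is, up to a symmetric factor, d/(x_j - x_k) (with y in place of x in the
second), which cancels on exchanging the two indices; for equal indices it is a vanishing second
difference. In [E_{n,n+1}, E_{n+1,n}] the mixed shifts cancel, and what remains is a sum of residues
evaluated by Lagrange interpolation at the 2n nodes x_j, x_j + d (`rowOp_commutator`).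

These identities hold away from the hyperplanes x_j - x_k = 0 and x_j - x_k = d. Since M identifies
functions that agree on a dense open set, this suffices: the computation takes place on honest
functions, in the algebra `genericOps`, and is carried to M by `genericEndHom`. -/

/-! ### Brackets of Chevalley generators with the candidates for matrix units. -/

section ChevalleyGenerators

variable {L : Type*} [LieRing L]

/-- Chevalley generators `h i`, `e i`, `f i` subject to the Serre presentation of `gl N`; the
sequences are indexed by `ℕ`, and only the relation between `e i` and `f i` knows about `N`. -/
structure IsChevalleySystem (N : ℕ) (h e f : ℕ → L) : Prop where
  lie_hh : ∀ i j, ⁅h i, h j⁆ = 0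
  lie_he : ∀ i j, ⁅h i, e j⁆ = ((if i = j then 1 else 0) - (if i = j + 1 then 1 else 0) : ℤ) • e j
  lie_hf : ∀ i j, ⁅h i, f j⁆ = ((if i = j + 1 then 1 else 0) - (if i = j then 1 else 0) : ℤ) • f j
  -- With the generators extended by zero out of range, this relation would fail at i = N - 1, where
  -- it would force `h (N - 1)` to vanish; the other relations survive the extension.
  lie_ef : ∀ i, i + 1 < N → ⁅e i, f i⁆ = h i - h (i + 1)
  lie_ef_of_ne : ∀ i j, i ≠ j → ⁅e i, f j⁆ = 0
  lie_ee : ∀ i j, i + 1 < j → ⁅e i, e j⁆ = 0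
  lie_ff : ∀ i j, i + 1 < j → ⁅f i, f j⁆ = 0
  serre_e : ∀ i, ⁅e i, ⁅e i, e (i + 1)⁆⁆ = 0
  serre_e' : ∀ i, ⁅e (i + 1), ⁅e (i + 1), e i⁆⁆ = 0
  serre_f : ∀ i, ⁅f i, ⁅f i, f (i + 1)⁆⁆ = 0
  serre_f' : ∀ i, ⁅f (i + 1), ⁅f (i + 1), f i⁆⁆ = 0

theorem lie_eq_zero_symm {a b : L} (h : ⁅a, b⁆ = 0) : ⁅b, a⁆ = 0 := by
  rw [← lie_skew, h, neg_zero]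

/-- The Chevalley involution. -/
theorem IsChevalleySystem.involution {N : ℕ} {h e f : ℕ → L} (H : IsChevalleySystem N h e f) :
    IsChevalleySystem N (fun i => -h i) (fun i => -f i) (fun i => -e i) where
  lie_hh i j := by simp [H.lie_hh]
  lie_he i j := by rw [lie_neg, neg_lie, neg_neg, H.lie_hf, smul_neg, ← neg_smul, neg_sub]
  lie_hf i j := by rw [lie_neg, neg_lie, neg_neg, H.lie_he, smul_neg, ← neg_smul, neg_sub]
  lie_ef i hi := by
    rw [lie_neg, neg_lie, neg_neg, ← lie_skew, H.lie_ef i hi]; abel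
  lie_ef_of_ne i j hij := by
    simp [lie_eq_zero_symm (H.lie_ef_of_ne j i hij.symm)]
  lie_ee i j hij := by simp [H.lie_ff i j hij]
  lie_ff i j hij := by simp [H.lie_ee i j hij]
  serre_e i := by simp [H.serre_f i]
  serre_e' i := by simp [H.serre_f' i]
  serre_f i := by simp [H.serre_e i]
  serre_f' i := by simp [H.serre_e' i]

/-- The iterated bracket `⁅⁅e k, e (k + 1)⁆, …, e (l - 1)⁆`. -/
def iteratedLie (e : ℕ → L) (k : ℕ) : ℕ → L
  | 0 => 0
  | l + 1 => if l < k then 0 else if l = k then e k else ⁅iteratedLie e k l, e l⁆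

theorem iteratedLie_self (e : ℕ → L) (k : ℕ) : iteratedLie e k (k + 1) = e k := by
  simp [iteratedLie]

theorem iteratedLie_succ (e : ℕ → L) {k l : ℕ} (h : k < l) :
    iteratedLie e k (l + 1) = ⁅iteratedLie e k l, e l⁆ := by
  simp [iteratedLie, h.not_gt, h.ne']

/-- The candidate for the image of the matrix unit `(k, l)`. -/
def chevalleyUnit (h e f : ℕ → L) (k l : ℕ) : L :=
  if k < l then iteratedLie e k l else if k = l then h k
    else -iteratedLie (fun i => -f i) l k

theorem chevalleyUnit_of_lt (h e f : ℕ → L) {k l : ℕ} (hkl : k < l) :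
    chevalleyUnit h e f k l = iteratedLie e k l := if_pos hkl

theorem chevalleyUnit_self (h e f : ℕ → L) (k : ℕ) : chevalleyUnit h e f k k = h k := by
  simp [chevalleyUnit]

/-- The signs in `chevalleyUnit` are chosen so that the involution acts as A ↦ -Aᵀ. Statements about
lower triangular units then follow from those about upper triangular ones. -/
theorem chevalleyUnit_involution (h e f : ℕ → L) (k l : ℕ) :
    chevalleyUnit (fun i => -h i) (fun i => -f i) (fun i => -e i) k l =
      -chevalleyUnit h e f l k := by
  unfold chevalleyUnit
  rcases lt_trichotomy k l with hkl | rfl | hkl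
  · simp [hkl, hkl.not_gt, hkl.ne']
  · simp
  · simp [hkl, hkl.not_gt, hkl.ne']

variable {N : ℕ} {h e f : ℕ → L}

theorem IsChevalleySystem.lie_e_iterated_of_gt (H : IsChevalleySystem N h e f) {k l i : ℕ}
    (hkl : k < l) (hi : l < i) : ⁅e i, iteratedLie e k l⁆ = 0 := by
  induction l, hkl using Nat.le_induction with
  | base => rw [iteratedLie_self]; exact lie_eq_zero_symm (H.lie_ee _ _ hi)
  | succ l hl ih =>
    rw [iteratedLie_succ e hl, leibniz_lie, ih (by lia),
      lie_eq_zero_symm (H.lie_ee l i hi)]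
    simp

theorem IsChevalleySystem.lie_e_iterated_of_lt (H : IsChevalleySystem N h e f) {k l i : ℕ}
    (hkl : k < l) (hi : i + 1 < k) : ⁅e i, iteratedLie e k l⁆ = 0 := by
  induction l, hkl using Nat.le_induction with
  | base => rw [iteratedLie_self]; exact H.lie_ee _ _ hi
  | succ l hl ih =>
    rw [iteratedLie_succ e hl, leibniz_lie, ih, H.lie_ee i l (by lia)]
    simp

theorem IsChevalleySystem.lie_e_iterated_pred (H : IsChevalleySystem N h e f) {i l : ℕ}
    (hkl : i + 1 < l) : ⁅e i, iteratedLie e (i + 1) l⁆ = iteratedLie e i l := by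
  induction l, hkl using Nat.le_induction with
  | base =>
    rw [iteratedLie_self, iteratedLie_succ e (by lia), iteratedLie_self]
  | succ l hl ih =>
    rw [iteratedLie_succ e hl, leibniz_lie, ih, H.lie_ee i l (by lia),
      iteratedLie_succ e (by lia : i < l)]
    simp

theorem IsChevalleySystem.lie_e_iterated_self (H : IsChevalleySystem N h e f) {i l : ℕ}
    (hkl : i < l) : ⁅e i, iteratedLie e i l⁆ = 0 := by
  induction l, hkl using Nat.le_induction with
  | base => rw [iteratedLie_self, lie_self]
  | succ l hl ih =>
    rw [iteratedLie_succ e hl]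
    rcases (show i + 1 = l ∨ i + 1 < l by lia) with rfl | hl'
    · rw [iteratedLie_self, H.serre_e]
    · rw [leibniz_lie, ih, H.lie_ee i l hl']
      simp

/-- The part of the iterated bracket before the last two factors commutes with the last one, so it
can be pulled out; what is left is the Serre relation of two neighbours. -/
theorem IsChevalleySystem.lie_e_iterated_last (H : IsChevalleySystem N h e f) {k i : ℕ}
    (hki : k < i) : ⁅e i, iteratedLie e k (i + 1)⁆ = 0 := by
  obtain ⟨i, rfl⟩ : ∃ j, i = j + 1 := ⟨i - 1, by lia⟩
  rw [iteratedLie_succ e hki]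
  rcases (show k = i ∨ k < i by lia) with rfl | hk
  · rw [iteratedLie_self, ← lie_skew (e k) (e (k + 1)), lie_neg, H.serre_e', neg_zero]
  · have h0 : ⁅e (i + 1), iteratedLie e k i⁆ = 0 := H.lie_e_iterated_of_gt hk (by lia)
    rw [iteratedLie_succ e hk, lie_lie (iteratedLie e k i), lie_eq_zero_symm h0, lie_zero,
      sub_zero, leibniz_lie, h0, zero_lie, zero_add, ← lie_skew (e i) (e (i + 1)), lie_neg,
      H.serre_e', neg_zero, lie_zero]

/-- In a Lie ring without torsion, the Serre relations for a chain of three elements. -/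
theorem lie_lie_lie_middle_eq_zero [IsAddTorsionFree L] {x y z : L} (hxz : ⁅x, z⁆ = 0)
    (hx : ⁅y, ⁅x, y⁆⁆ = 0) (hz : ⁅y, ⁅y, z⁆⁆ = 0) : ⁅y, ⁅⁅x, y⁆, z⁆⁆ = 0 := by
  have h1 : ⁅y, ⁅⁅x, y⁆, z⁆⁆ = ⁅⁅x, y⁆, ⁅y, z⁆⁆ := by
    rw [leibniz_lie, hx, zero_lie, zero_add]
  have h2 : ⁅⁅x, y⁆, z⁆ = ⁅x, ⁅y, z⁆⁆ := by
    rw [lie_lie, hxz, lie_zero, sub_zero]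
  have h3 : ⁅⁅x, y⁆, ⁅y, z⁆⁆ = -⁅y, ⁅⁅x, y⁆, z⁆⁆ := by
    rw [lie_lie, hz, lie_zero, zero_sub, h2]
  rw [h3] at h1
  -- The element equals its own negative, and there is no 2-torsion.
  exact self_eq_neg.1 h1

/-- At l = i + 2 the bracket is a chain x, y, z with y = `e i` in the middle and x the iterated
bracket from `k` to `i`; later factors commute with `e i`. -/
theorem IsChevalleySystem.lie_e_iterated_mid [IsAddTorsionFree L] (H : IsChevalleySystem N h e f)
    {k l i : ℕ} (hki : k < i) (hil : i + 1 < l) : ⁅e i, iteratedLie e k l⁆ = 0 := by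
  induction l, hil using Nat.le_induction with
  | base =>
    rw [iteratedLie_succ e (by lia), iteratedLie_succ e hki]
    refine lie_lie_lie_middle_eq_zero
      (lie_eq_zero_symm (H.lie_e_iterated_of_gt hki (by lia))) ?_ (H.serre_e i)
    rw [← iteratedLie_succ e hki]
    exact H.lie_e_iterated_last hki
  | succ l hl ih =>
    rw [iteratedLie_succ e (by lia), leibniz_lie, ih, H.lie_ee i l hl]
    simp

theorem IsChevalleySystem.lie_h_iterated (H : IsChevalleySystem N h e f) {k l : ℕ} (i : ℕ)
    (hkl : k < l) : ⁅h i, iteratedLie e k l⁆ =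
      ((if i = k then 1 else 0) - (if i = l then 1 else 0) : ℤ) • iteratedLie e k l := by
  induction l, hkl using Nat.le_induction with
  | base => rw [iteratedLie_self, H.lie_he]
  | succ l hl ih =>
    rw [iteratedLie_succ e hl, leibniz_lie, ih, H.lie_he, smul_lie, lie_smul, ← add_smul]
    congr 1
    ring

theorem IsChevalleySystem.lie_e_unit_of_lt [IsAddTorsionFree L] (H : IsChevalleySystem N h e f)
    {k l : ℕ} (i : ℕ) (hkl : k < l) : ⁅e i, chevalleyUnit h e f k l⁆ =
      (if i + 1 = k then chevalleyUnit h e f i l else 0) -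
        (if l = i then chevalleyUnit h e f k (i + 1) else 0) := by
  rw [chevalleyUnit_of_lt h e f hkl]
  rcases lt_trichotomy l i with hi | rfl | hi
  · rw [H.lie_e_iterated_of_gt hkl hi, if_neg (by lia), if_neg (by lia), sub_zero]
  · rw [if_neg (by lia), if_pos rfl, chevalleyUnit_of_lt h e f (by lia), iteratedLie_succ e hkl,
      zero_sub, lie_skew]
  · rw [if_neg hi.ne', sub_zero]
    rcases lt_trichotomy (i + 1) k with hk | rfl | hk
    · rw [H.lie_e_iterated_of_lt hkl hk, if_neg hk.ne]
    · rw [H.lie_e_iterated_pred hkl, if_pos rfl, chevalleyUnit_of_lt h e f hi]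
    · rw [if_neg hk.ne']
      rcases (show k = i ∨ k < i by lia) with rfl | hk'
      · exact H.lie_e_iterated_self hi
      · rcases (show l = i + 1 ∨ i + 1 < l by lia) with rfl | hl
        · exact H.lie_e_iterated_last hk'
        · exact H.lie_e_iterated_mid hk' hl

/-- Leibniz rule along the iterated bracket: `f i` meets a nonzero bracket only at the factor `e i`,
which it turns into a difference of two `h`. The bound l < N keeps every such index in the range of
`lie_ef`. -/
theorem IsChevalleySystem.lie_f_unit_of_lt (H : IsChevalleySystem N h e f)
    {k l : ℕ} (i : ℕ) (hkl : k < l) (hl : l < N) : ⁅f i, chevalleyUnit h e f k l⁆ =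
      (if i = k then chevalleyUnit h e f (i + 1) l else 0) -
        (if l = i + 1 then chevalleyUnit h e f k i else 0) := by
  induction l, hkl using Nat.le_induction with
  | base =>
    rw [chevalleyUnit_of_lt h e f (by lia), iteratedLie_self]
    rcases eq_or_ne i k with rfl | hik
    · rw [if_pos rfl, if_pos rfl, chevalleyUnit_self, chevalleyUnit_self, ← lie_skew,
        H.lie_ef i hl, neg_sub]
    · rw [if_neg hik, if_neg (by lia), lie_eq_zero_symm (H.lie_ef_of_ne k i hik.symm), sub_zero]
  | succ l hl' ih =>
    have hfe : l ≠ i → ⁅f i, e l⁆ = 0 := fun hli => lie_eq_zero_symm (H.lie_ef_of_ne l i hli)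
    rw [chevalleyUnit_of_lt h e f (by lia), iteratedLie_succ e hl', leibniz_lie,
      ← chevalleyUnit_of_lt h e f hl', ih (by lia)]
    -- If l = i, only the new factor contributes, and `h l - h (l + 1)` has weight -1 on the shorter
    -- bracket.
    rcases eq_or_ne l i with rfl | hli
    · rw [if_neg (by lia), if_neg (by lia), if_neg (by lia), if_pos rfl, sub_zero, zero_lie,
        zero_add, ← lie_skew (f l), H.lie_ef l hl, chevalleyUnit_of_lt h e f hl', ← lie_skew,
        neg_lie, neg_neg, sub_lie, H.lie_h_iterated l hl', H.lie_h_iterated (l + 1) hl',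
        if_neg (by lia), if_pos rfl, if_neg (by lia), if_neg (by lia)]
      simp
    · rw [hfe hli, lie_zero, add_zero, if_neg (by lia : ¬ l + 1 = i + 1), sub_zero]
      rcases eq_or_ne i k with rfl | hik
      · rw [if_pos rfl, if_pos rfl, chevalleyUnit_of_lt h e f (by lia : i + 1 < l + 1)]
        rcases (show l = i + 1 ∨ i + 1 < l by lia) with rfl | hil
        · rw [if_pos rfl, chevalleyUnit_self, chevalleyUnit_self, iteratedLie_self, sub_lie,
            H.lie_he, H.lie_he, if_pos rfl, if_neg (by lia), if_neg (by lia), if_neg (by lia)]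
          simp
        · rw [if_neg (by lia), sub_zero, chevalleyUnit_of_lt h e f hil, iteratedLie_succ e hil]
      · rw [if_neg hik, if_neg hik, zero_sub, neg_lie, neg_eq_zero]
        split_ifs with hl2
        · subst hl2
          rw [chevalleyUnit_of_lt h e f (by lia)]
          exact lie_eq_zero_symm (H.lie_e_iterated_of_gt (by lia) (by lia))
        · exact zero_lie _

theorem IsChevalleySystem.lie_e_unit [IsAddTorsionFree L] (H : IsChevalleySystem N h e f)
    {k l i : ℕ} (hk : k < N) (hi : i + 1 < N) : ⁅e i, chevalleyUnit h e f k l⁆ =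
      (if i + 1 = k then chevalleyUnit h e f i l else 0) -
        (if l = i then chevalleyUnit h e f k (i + 1) else 0) := by
  rcases lt_trichotomy k l with hkl | rfl | hkl
  · exact H.lie_e_unit_of_lt i hkl
  · rw [chevalleyUnit_self, ← lie_skew, H.lie_he]
    rcases eq_or_ne (i + 1) k with rfl | h1
    · rw [if_pos rfl, if_neg (by lia), if_pos rfl, if_neg (by lia),
        chevalleyUnit_of_lt h e f (by lia), iteratedLie_self]
      simp
    · rw [if_neg h1, if_neg h1.symm]
      split_ifs with h2
      · subst h2
        rw [chevalleyUnit_of_lt h e f (by lia), iteratedLie_self]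
        simp
      · simp
  · have := H.involution.lie_f_unit_of_lt i hkl hk
    simp only [chevalleyUnit_involution, lie_neg, neg_lie, neg_neg] at this
    rw [this]
    split_ifs <;> first | lia | simp [neg_add_eq_sub]

theorem IsChevalleySystem.lie_f_unit [IsAddTorsionFree L] (H : IsChevalleySystem N h e f)
    {k l i : ℕ} (hl : l < N) (hi : i + 1 < N) : ⁅f i, chevalleyUnit h e f k l⁆ =
      (if i = k then chevalleyUnit h e f (i + 1) l else 0) -
        (if l = i + 1 then chevalleyUnit h e f k i else 0) := by
  have := H.involution.lie_e_unit (k := l) (l := k) hl hi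
  simp only [chevalleyUnit_involution, lie_neg, neg_lie, neg_neg] at this
  rw [this]
  split_ifs <;> first | lia | simp [neg_add_eq_sub]

theorem IsChevalleySystem.lie_h_unit (H : IsChevalleySystem N h e f) (k l i : ℕ) :
    ⁅h i, chevalleyUnit h e f k l⁆ =
      (if i = k then chevalleyUnit h e f i l else 0) -
        (if l = i then chevalleyUnit h e f k i else 0) := by
  have key : ⁅h i, chevalleyUnit h e f k l⁆ =
      ((if i = k then 1 else 0) - (if i = l then 1 else 0) : ℤ) • chevalleyUnit h e f k l := by
    rcases lt_trichotomy k l with hkl | rfl | hkl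
    · rw [chevalleyUnit_of_lt h e f hkl, H.lie_h_iterated i hkl]
    · rw [chevalleyUnit_self, H.lie_hh, sub_self, zero_smul]
    · have := H.involution.lie_h_iterated i hkl
      rw [← chevalleyUnit_of_lt (fun i => -h i) _ (fun i => -e i) hkl, chevalleyUnit_involution,
        neg_lie, lie_neg, neg_neg] at this
      rw [this, smul_neg, ← neg_smul, neg_sub]
  rw [key, sub_smul]
  simp only [eq_comm (a := l)]
  split_ifs with h1 h2 h2
  · subst h1 h2; simp
  · subst h1; simp
  · subst h2; simp
  · simp

end ChevalleyGenerators

/-! ### Generation of gl(N) by the diagonal and the neighbouring matrix units. -/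

section MatrixUnits

variable {N : ℕ}

theorem lie_single_single (i j k l : Fin N) :
    ⁅(Matrix.single i j 1 : Matrix (Fin N) (Fin N) ℂ),
        (Matrix.single k l 1 : Matrix (Fin N) (Fin N) ℂ)⁆ =
      (if j = k then Matrix.single i l 1 else 0) - (if l = i then Matrix.single k j 1 else 0) := by
  rw [LieRing.of_associative_ring_bracket]
  congr 1
  · split_ifs with h
    · subst h; simp
    · simp [h]
  · split_ifs with h
    · subst h; simp
    · simp [h]

theorem lieSubalgebra_eq_top_of_single_mem (S : LieSubalgebra ℂ (Matrix (Fin N) (Fin N) ℂ))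
    (hd : ∀ (k : ℕ) (hk : k < N), Matrix.single ⟨k, hk⟩ ⟨k, hk⟩ 1 ∈ S)
    (hr : ∀ (k : ℕ) (hk : k + 1 < N),
      Matrix.single ⟨k, Nat.lt_of_succ_lt hk⟩ ⟨k + 1, hk⟩ 1 ∈ S)
    (hl : ∀ (k : ℕ) (hk : k + 1 < N),
      Matrix.single ⟨k + 1, hk⟩ ⟨k, Nat.lt_of_succ_lt hk⟩ 1 ∈ S) : S = ⊤ := by
  have upper : ∀ (k : ℕ) (l : ℕ) (hkl : k < l) (hk : k < N) (hl : l < N),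
      Matrix.single ⟨k, hk⟩ ⟨l, hl⟩ 1 ∈ S ∧ Matrix.single ⟨l, hl⟩ ⟨k, hk⟩ 1 ∈ S := by
    intro k l hkl
    induction l, hkl using Nat.le_induction with
    | base => exact fun hk hl' => ⟨hr k hl', hl k hl'⟩
    | succ l hkl ih =>
      intro hk hl'
      obtain ⟨h1, h2⟩ := ih hk (by lia)
      have a1 := S.lie_mem h1 (hr l hl')
      have a2 := S.lie_mem (hl l hl') h2
      rw [lie_single_single, if_pos rfl, if_neg (by simp; lia), sub_zero] at a1 a2
      exact ⟨a1, a2⟩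
  refine eq_top_iff.2 fun A _ => ?_
  rw [Matrix.matrix_eq_sum_single A]
  refine sum_mem fun i _ => sum_mem fun j _ => ?_
  rw [← mul_one (A i j), ← smul_eq_mul, ← Matrix.smul_single]
  refine S.smul_mem _ ?_
  rcases lt_trichotomy (i : ℕ) j with hij | hij | hij
  · exact (upper i j hij i.2 j.2).1
  · obtain rfl := Fin.ext hij
    exact hd i i.2
  · exact (upper j i hij j.2 i.2).2

end MatrixUnits

/-! ### The homomorphism attached to a Chevalley system. -/

section ChevalleyHom

variable {L : Type*} [LieRing L] [LieAlgebra ℂ L] {N : ℕ} {h e f : ℕ → L}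

/-- The linear map sending the matrix units to the elements `chevalleyUnit h e f k l`. -/
noncomputable def chevalleyLinearMap (N : ℕ) (h e f : ℕ → L) :
    Matrix (Fin N) (Fin N) ℂ →ₗ[ℂ] L where
  toFun A := ∑ i, ∑ j, A i j • chevalleyUnit h e f i j
  map_add' A B := by simp [add_smul, Finset.sum_add_distrib]
  map_smul' c A := by simp [mul_smul, Finset.smul_sum]

theorem chevalleyLinearMap_single (i j : Fin N) :
    chevalleyLinearMap N h e f (Matrix.single i j 1) = chevalleyUnit h e f i j := by
  simp only [chevalleyLinearMap, LinearMap.coe_mk, AddHom.coe_mk]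
  rw [Finset.sum_eq_single i, Finset.sum_eq_single j]
  · simp
  · intro b _ hb; simp [hb.symm]
  · simp
  · intro b _ hb; simp [hb.symm]
  · simp

/-- The elements on which a linear map respects all brackets form a Lie subalgebra. -/
def lieSubalgebraOfMapLie {K : Type*} [LieRing K] [LieAlgebra ℂ K] (φ : K →ₗ[ℂ] L) :
    LieSubalgebra ℂ K where
  carrier := {x | ∀ y, φ ⁅x, y⁆ = ⁅φ x, φ y⁆}
  zero_mem' y := by simp
  add_mem' hx hx' y := by simp [hx y, hx' y]
  smul_mem' c x hx y := by simp [hx y]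
  lie_mem' {x x'} hx hx' y := by
    rw [lie_lie, map_sub, hx, hx', hx', hx, hx x', ← lie_lie]

/-- The Lie subalgebra on which two homomorphisms agree. -/
def lieHomEqLocus {K : Type*} [LieRing K] [LieAlgebra ℂ K] (φ ψ : K →ₗ⁅ℂ⁆ L) :
    LieSubalgebra ℂ K where
  carrier := {x | φ x = ψ x}
  zero_mem' := by simp
  add_mem' {x x'} hx hx' := by
    change φ (x + x') = ψ (x + x')
    rw [map_add, map_add, show φ x = ψ x from hx, show φ x' = ψ x' from hx']
  smul_mem' c x hx := by
    change φ (c • x) = ψ (c • x)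
    rw [map_smul, map_smul, show φ x = ψ x from hx]
  lie_mem' {x x'} hx hx' := by
    change φ ⁅x, x'⁆ = ψ ⁅x, x'⁆
    rw [LieHom.map_lie, LieHom.map_lie, show φ x = ψ x from hx, show φ x' = ψ x' from hx']

theorem IsChevalleySystem.map_lie [IsAddTorsionFree L] (H : IsChevalleySystem N h e f)
    (A B : Matrix (Fin N) (Fin N) ℂ) :
    chevalleyLinearMap N h e f ⁅A, B⁆ =
      ⁅chevalleyLinearMap N h e f A, chevalleyLinearMap N h e f B⁆ := by
  suffices hS : lieSubalgebraOfMapLie (chevalleyLinearMap N h e f) = ⊤ by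
    have : A ∈ lieSubalgebraOfMapLie (chevalleyLinearMap N h e f) := hS ▸ LieSubalgebra.mem_top A
    exact this B
  -- By linearity in the second argument, membership of a matrix unit in the subalgebra is a finite
  -- list of brackets; it is verified only for the generators.
  have red : ∀ i j : Fin N, (∀ k l : Fin N, ⁅chevalleyUnit h e f i j, chevalleyUnit h e f k l⁆ =
      (if (j : ℕ) = k then chevalleyUnit h e f i l else 0) -
        (if (l : ℕ) = i then chevalleyUnit h e f k j else 0)) →
      Matrix.single i j 1 ∈ lieSubalgebraOfMapLie (chevalleyLinearMap N h e f) := by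
    intro i j hij B
    rw [Matrix.matrix_eq_sum_single B]
    simp only [lie_sum, map_sum]
    refine Finset.sum_congr rfl fun k _ => Finset.sum_congr rfl fun l _ => ?_
    rw [← mul_one (B k l), ← smul_eq_mul, ← Matrix.smul_single, lie_smul, map_smul, map_smul,
      lie_smul, lie_single_single, chevalleyLinearMap_single, chevalleyLinearMap_single, hij,
      map_sub]
    congr 2
    · simp only [Fin.ext_iff]; split_ifs <;> simp [chevalleyLinearMap_single]
    · simp only [Fin.ext_iff]; split_ifs <;> simp [chevalleyLinearMap_single]
  refine lieSubalgebra_eq_top_of_single_mem _ (fun k hk => red _ _ fun i j => ?_)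
    (fun k hk => red _ _ fun i j => ?_) (fun k hk => red _ _ fun i j => ?_)
  · rw [chevalleyUnit_self]; exact H.lie_h_unit _ _ _
  · have := H.lie_e_unit (l := j) i.2 hk
    rwa [show chevalleyUnit h e f k (k + 1) = e k by
      rw [chevalleyUnit_of_lt h e f (by lia), iteratedLie_self]]
  · have := H.lie_f_unit (k := i) j.2 hk
    rwa [show chevalleyUnit h e f (k + 1) k = f k by
      rw [chevalleyUnit, if_neg (by lia), if_neg (by lia), iteratedLie_self, neg_neg]]

/-- The homomorphism from `gl N` given by a system of Chevalley generators. -/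
noncomputable def IsChevalleySystem.lieHom [IsAddTorsionFree L] (H : IsChevalleySystem N h e f) :
    Matrix (Fin N) (Fin N) ℂ →ₗ⁅ℂ⁆ L :=
  { chevalleyLinearMap N h e f with map_lie' := fun {A B} => H.map_lie A B }

theorem IsChevalleySystem.lieHom_diag [IsAddTorsionFree L] (H : IsChevalleySystem N h e f)
    {k : ℕ} (hk : k < N) : H.lieHom (Matrix.single ⟨k, hk⟩ ⟨k, hk⟩ 1) = h k :=
  (chevalleyLinearMap_single _ _).trans (chevalleyUnit_self h e f k)

theorem IsChevalleySystem.lieHom_raise [IsAddTorsionFree L] (H : IsChevalleySystem N h e f)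
    {k : ℕ} (hk : k + 1 < N) :
    H.lieHom (Matrix.single ⟨k, Nat.lt_of_succ_lt hk⟩ ⟨k + 1, hk⟩ 1) = e k :=
  (chevalleyLinearMap_single _ _).trans
    (by rw [chevalleyUnit_of_lt h e f (by simp), iteratedLie_self])

theorem IsChevalleySystem.lieHom_lower [IsAddTorsionFree L] (H : IsChevalleySystem N h e f)
    {k : ℕ} (hk : k + 1 < N) :
    H.lieHom (Matrix.single ⟨k + 1, hk⟩ ⟨k, Nat.lt_of_succ_lt hk⟩ 1) = f k :=
  (chevalleyLinearMap_single _ _).trans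
    (by rw [chevalleyUnit, if_neg (by simp), if_neg (by simp), iteratedLie_self, neg_neg])

end ChevalleyHom

/-! ### Relations between difference operators on abstract rows. -/

section RowOperators

variable {X : Type*} {J R Q J' R' : Type*} [Fintype J] [DecidableEq J] [Fintype R]
  [Fintype Q] [Fintype J'] [DecidableEq J'] [Fintype R']

/-- The coefficient of the `j`-th shift in a row operator. -/
noncomputable def rowCoeff (x : J → X → ℂ) (y : R → X → ℂ) (d : ℂ) (j : J) (γ : X) : ℂ :=
  (∏ r, (x j γ - y r γ - d / 2)) / ∏ s ∈ Finset.univ.erase j, (x j γ - x s γ)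

/-- The difference operator in the row `x` whose coefficients couple it to the row `y`. -/
noncomputable def rowOp (x : J → X → ℂ) (y : R → X → ℂ) (σ : J → X → X) (d : ℂ) :
    (X → ℂ) →ₗ[ℂ] (X → ℂ) where
  toFun f γ := ∑ j, rowCoeff x y d j γ * f (σ j γ)
  map_add' f g := by ext γ; simp [mul_add, Finset.sum_add_distrib]
  map_smul' c f := by
    ext γ
    simp only [Pi.smul_apply, smul_eq_mul, RingHom.id_apply, Finset.mul_sum]
    exact Finset.sum_congr rfl fun j _ => by ring

theorem rowOp_apply (x : J → X → ℂ) (y : R → X → ℂ) (σ : J → X → X) (d : ℂ) (f : X → ℂ) (γ : X) :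
    rowOp x y σ d f γ = ∑ j, rowCoeff x y d j γ * f (σ j γ) := rfl

/-- The maps `σ j` shift the coordinate `x j` by `-d`. -/
def ShiftsRow (σ : J → X → X) (x : J → X → ℂ) (d : ℂ) : Prop :=
  ∀ j γ k, x k (σ j γ) = x k γ - if k = j then d else 0

/-- The maps `σ j` leave the row `y` unchanged. -/
def FixesRow (σ : J → X → X) (y : R → X → ℂ) : Prop :=
  ∀ j γ r, y r (σ j γ) = y r γ

theorem rowCoeff_congr {x : J → X → ℂ} {y : R → X → ℂ} {d : ℂ} {j : J} {γ γ' : X}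
    (hx : ∀ s, x s γ' = x s γ) (hy : ∀ r, y r γ' = y r γ) :
    rowCoeff x y d j γ' = rowCoeff x y d j γ := by
  simp only [rowCoeff, hx, hy]

/-- The part of a coefficient that comes from the factors in `S` and `T`. -/
noncomputable def rowRest (x : J → X → ℂ) (y : R → X → ℂ) (d : ℂ) (S : Finset R) (T : Finset J)
    (j : J) (γ : X) : ℂ :=
  (∏ r ∈ S, (x j γ - y r γ - d / 2)) / ∏ s ∈ T, (x j γ - x s γ)

omit [Fintype J] [DecidableEq J] [Fintype R] in
theorem rowRest_congr {x : J → X → ℂ} {y : R → X → ℂ} {d : ℂ} {S : Finset R} {T : Finset J}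
    {j : J} {γ γ' : X} (hj : x j γ' = x j γ) (hx : ∀ s ∈ T, x s γ' = x s γ)
    (hy : ∀ r ∈ S, y r γ' = y r γ) : rowRest x y d S T j γ' = rowRest x y d S T j γ := by
  unfold rowRest
  congr 1
  · exact Finset.prod_congr rfl fun r hr => by rw [hj, hy r hr]
  · exact Finset.prod_congr rfl fun s hs => by rw [hj, hx s hs]

/-- This and the next three lemmas split off the factors containing chosen entries x_k, y_l, y_m.
The rest does not involve those entries, so shifting them leaves it unchanged. -/
theorem rowCoeff_eq_rest_div {x : J → X → ℂ} (y : R → X → ℂ) (d : ℂ) {j k : J} (hjk : k ≠ j)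
    (γ : X) : rowCoeff x y d j γ =
      rowRest x y d Finset.univ ((Finset.univ.erase j).erase k) j γ * (x j γ - x k γ)⁻¹ := by
  unfold rowCoeff rowRest
  rw [← Finset.mul_prod_erase (Finset.univ.erase j) _ (Finset.mem_erase.2 ⟨hjk, Finset.mem_univ k⟩)]
  rw [div_eq_mul_inv, mul_inv, div_eq_mul_inv]; ring

theorem rowCoeff_eq_rest_mul [DecidableEq R] (x : J → X → ℂ) (y : R → X → ℂ) (d : ℂ) (j : J)
    (l : R) (γ : X) : rowCoeff x y d j γ =
      rowRest x y d (Finset.univ.erase l) (Finset.univ.erase j) j γ * (x j γ - y l γ - d / 2) := by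
  unfold rowCoeff rowRest
  rw [← Finset.mul_prod_erase Finset.univ _ (Finset.mem_univ l)]
  ring

theorem rowCoeff_eq_rest_mul_mul [DecidableEq R] (x : J → X → ℂ) (y : R → X → ℂ) (d : ℂ) (j : J)
    {l m : R} (hlm : m ≠ l) (γ : X) : rowCoeff x y d j γ =
      rowRest x y d ((Finset.univ.erase l).erase m) (Finset.univ.erase j) j γ *
        ((x j γ - y l γ - d / 2) * (x j γ - y m γ - d / 2)) := by
  unfold rowCoeff rowRest
  rw [← Finset.mul_prod_erase Finset.univ _ (Finset.mem_univ l),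
    ← Finset.mul_prod_erase (Finset.univ.erase l) _ (Finset.mem_erase.2 ⟨hlm, Finset.mem_univ m⟩)]
  ring

theorem rowCoeff_eq_rest_mul_div [DecidableEq R] (x : J → X → ℂ) (y : R → X → ℂ) (d : ℂ) {j k : J}
    (hjk : k ≠ j) (l : R) (γ : X) : rowCoeff x y d j γ =
      rowRest x y d (Finset.univ.erase l) ((Finset.univ.erase j).erase k) j γ *
        ((x j γ - y l γ - d / 2) / (x j γ - x k γ)) := by
  unfold rowCoeff rowRest
  rw [← Finset.mul_prod_erase Finset.univ _ (Finset.mem_univ l),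
    ← Finset.mul_prod_erase (Finset.univ.erase j) _ (Finset.mem_erase.2 ⟨hjk, Finset.mem_univ k⟩)]
  rw [div_eq_mul_inv, mul_inv, div_eq_mul_inv, div_eq_mul_inv]; ring

theorem rowOp_comm_of_coeff {x : J → X → ℂ} {y : R → X → ℂ} {σ : J → X → X} {d : ℂ}
    {x' : J' → X → ℂ} {y' : R' → X → ℂ} {σ' : J' → X → X} {d' : ℂ} {γ : X}
    (hc : ∀ j k, rowCoeff x y d j γ * rowCoeff x' y' d' k (σ j γ) =
      rowCoeff x' y' d' k γ * rowCoeff x y d j (σ' k γ))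
    (hσ : ∀ j k, σ' k (σ j γ) = σ j (σ' k γ)) (f : X → ℂ) :
    rowOp x y σ d (rowOp x' y' σ' d' f) γ = rowOp x' y' σ' d' (rowOp x y σ d f) γ := by
  simp only [rowOp_apply, Finset.mul_sum]
  rw [Finset.sum_comm]
  refine Finset.sum_congr rfl fun k _ => Finset.sum_congr rfl fun j _ => ?_
  rw [← mul_assoc, hc, hσ, mul_assoc]

theorem rowOp_comm_of_fixes {x : J → X → ℂ} {y : R → X → ℂ} {σ : J → X → X} {d : ℂ}
    {x' : J' → X → ℂ} {y' : R' → X → ℂ} {σ' : J' → X → X} {d' : ℂ}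
    (hx' : FixesRow σ x') (hy' : FixesRow σ y') (hx : FixesRow σ' x) (hy : FixesRow σ' y)
    (hσ : ∀ j k γ, σ' k (σ j γ) = σ j (σ' k γ)) (f : X → ℂ) (γ : X) :
    rowOp x y σ d (rowOp x' y' σ' d' f) γ = rowOp x' y' σ' d' (rowOp x y σ d f) γ := by
  refine rowOp_comm_of_coeff (fun j k => ?_) (fun j k => hσ j k γ) f
  rw [rowCoeff_congr (fun s => hx' j γ s) (fun r => hy' j γ r),
    rowCoeff_congr (fun s => hx k γ s) (fun r => hy k γ r), mul_comm]

/-- Only the factor joining x_j and y_k feels both shifts. With u = x_j - y_k - d/2, either order of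
the operators yields -u(u - d). -/
theorem rowOp_comm_opposite [DecidableEq R] {x : J → X → ℂ} {y : R → X → ℂ} {σ : J → X → X}
    {τ : R → X → X} {d : ℂ} (hσx : ShiftsRow σ x d) (hσy : FixesRow σ y)
    (hτy : ShiftsRow τ y (-d)) (hτx : FixesRow τ x)
    (hστ : ∀ j k γ, τ k (σ j γ) = σ j (τ k γ)) (f : X → ℂ) (γ : X) :
    rowOp x y σ d (rowOp y x τ (-d) f) γ = rowOp y x τ (-d) (rowOp x y σ d f) γ := by
  refine rowOp_comm_of_coeff (fun j k => ?_) (fun j k => hστ j k γ) f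
  rw [rowCoeff_eq_rest_mul x y d j k, rowCoeff_eq_rest_mul x y d j k,
    rowCoeff_eq_rest_mul y x (-d) k j, rowCoeff_eq_rest_mul y x (-d) k j,
    rowRest_congr (hσy j γ k) (fun r _ => hσy j γ r)
      (fun r hr => by rw [hσx, if_neg (Finset.ne_of_mem_erase hr), sub_zero]),
    rowRest_congr (hτx k γ j) (fun r _ => hτx k γ r)
      (fun r hr => by rw [hτy, if_neg (Finset.ne_of_mem_erase hr), sub_zero]),
    hσx, hτy, hτx, hσy, if_pos rfl, if_pos rfl]
  ring

/-- A sum over pairs vanishes if its terms are antisymmetric. -/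
theorem sum_sum_eq_zero_of_antisymm {ι : Type*} [Fintype ι] (C : ι → ι → ℂ)
    (h : ∀ j k, C j k + C k j = 0) : ∑ j, ∑ k, C j k = 0 := by
  have h1 : ∑ j, ∑ k, C j k + ∑ j, ∑ k, C j k = 0 := by
    nth_rw 2 [Finset.sum_comm]
    simp only [← Finset.sum_add_distrib, h, Finset.sum_const_zero]
  exact self_eq_neg.1 (eq_neg_of_add_eq_zero_left h1)

/-- Fix l and put u_j = x_j - y_l - d/2; the shift τ_l raises u_j by d. For j = k the coefficient is
a multiple of u(u - d) - 2u² + (u + d)u = 0. For j ≠ k its numerator u_j u_k - 2u_j(u_k + d) + (u_j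
+ d)(u_k + d) equals d(x_k - x_j + d) and cancels the denominator created by σ_j. This leaves d/(x_j
- x_k) times a symmetric factor. -/
theorem rowOp_serre_left [DecidableEq R] {x : J → X → ℂ} {y : R → X → ℂ} {z : Q → X → ℂ}
    {σ : J → X → X} {τ : R → X → X} {d : ℂ} (hσx : ShiftsRow σ x d) (hσy : FixesRow σ y)
    (hσz : FixesRow σ z) (hτy : ShiftsRow τ y d) (hτx : FixesRow τ x)
    (hσσ : ∀ j k γ, σ k (σ j γ) = σ j (σ k γ)) (hστ : ∀ j l γ, τ l (σ j γ) = σ j (τ l γ))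
    {γ : X} (h0 : ∀ j k, j ≠ k → x j γ - x k γ ≠ 0) (h1 : ∀ j k, j ≠ k → x j γ - x k γ ≠ d)
    (f : X → ℂ) :
    rowOp x y σ d (rowOp x y σ d (rowOp y z τ d f)) γ -
      2 * rowOp x y σ d (rowOp y z τ d (rowOp x y σ d f)) γ +
      rowOp y z τ d (rowOp x y σ d (rowOp x y σ d f)) γ = 0 := by
  have hB : ∀ l j γ, rowCoeff y z d l (σ j γ) = rowCoeff y z d l γ := fun l j γ =>
    rowCoeff_congr (fun s => hσy j γ s) (fun r => hσz j γ r)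
  have hτu : ∀ j l γ, x j (τ l γ) - y l (τ l γ) - d / 2 = x j γ - y l γ - d / 2 + d := by
    intro j l γ; rw [hτx, hτy, if_pos rfl]; ring
  set A := rowCoeff x y d with hA
  set B := rowCoeff y z d with hB'
  have key : ∀ l j k,
      (A j γ * A k (σ j γ) - 2 * (A j γ * A k (τ l (σ j γ))) + A j (τ l γ) * A k (τ l (σ j γ))) +
      (A k γ * A j (σ k γ) - 2 * (A k γ * A j (τ l (σ k γ))) + A k (τ l γ) * A j (τ l (σ k γ)))
        = 0 := by
    intro l j k
    rcases eq_or_ne j k with rfl | hjk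
    · have e1 : ∀ γ, A j γ = _ := rowCoeff_eq_rest_mul x y d j l
      have e2 : ∀ γ, rowRest x y d (Finset.univ.erase l) (Finset.univ.erase j) j (τ l γ) =
          rowRest x y d (Finset.univ.erase l) (Finset.univ.erase j) j γ := fun γ =>
        rowRest_congr (hτx _ _ _) (fun _ _ => hτx _ _ _) (fun r hr => by
          rw [hτy, if_neg (Finset.ne_of_mem_erase hr), sub_zero])
      simp only [e1, e2, hτu]
      rw [hσx, hσy, if_pos rfl]
      ring
    · have e1 : ∀ j k, k ≠ j → ∀ γ, A j γ = _ := fun j k h γ =>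
        rowCoeff_eq_rest_mul_div x y d h l γ
      have e2 : ∀ j k γ, rowRest x y d (Finset.univ.erase l) ((Finset.univ.erase j).erase k) j
          (τ l γ) = rowRest x y d (Finset.univ.erase l) ((Finset.univ.erase j).erase k) j γ :=
        fun j k γ => rowRest_congr (hτx _ _ _) (fun _ _ => hτx _ _ _) (fun r hr => by
          rw [hτy, if_neg (Finset.ne_of_mem_erase hr), sub_zero])
      have e3 : ∀ j k γ, k ≠ j →
          rowRest x y d (Finset.univ.erase l) ((Finset.univ.erase j).erase k) j (σ k γ) =
          rowRest x y d (Finset.univ.erase l) ((Finset.univ.erase j).erase k) j γ :=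
        fun j k γ hjk => rowRest_congr (by rw [hσx, if_neg hjk.symm, sub_zero])
          (fun s hs => by rw [hσx, if_neg (Finset.ne_of_mem_erase hs), sub_zero])
          (fun _ _ => hσy _ _ _)
      simp only [e1 j k hjk.symm, e1 k j hjk, e2, e3 j k _ hjk.symm, e3 k j _ hjk, hτu]
      have hτx' : ∀ l γ s, x s (τ l γ) = x s γ := hτx
      simp only [hτx']
      rw [hσx j γ k, hσx k γ j, hσx j γ j, hσx k γ k, hσy, hσy, if_neg hjk,
        if_neg hjk.symm, if_pos rfl, if_pos rfl, sub_zero, sub_zero]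
      have n1 := h0 j k hjk
      have n2 := h0 k j hjk.symm
      have n3 : x k γ - (x j γ - d) ≠ 0 := fun h => h1 j k hjk (by linear_combination -h)
      have n4 : x j γ - (x k γ - d) ≠ 0 := fun h => h1 k j hjk.symm (by linear_combination -h)
      generalize rowRest x y d _ _ j γ = p
      generalize rowRest x y d _ _ k γ = q
      field_simp
      ring
  -- All three products are written over the common shift τ_l σ_k σ_j, so that their coefficients
  -- can be compared.
  have hsum : rowOp x y σ d (rowOp x y σ d (rowOp y z τ d f)) γ -
      2 * rowOp x y σ d (rowOp y z τ d (rowOp x y σ d f)) γ +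
      rowOp y z τ d (rowOp x y σ d (rowOp x y σ d f)) γ =
      ∑ l, ∑ j, ∑ k, B l γ * f (τ l (σ k (σ j γ))) * (A j γ * A k (σ j γ) -
        2 * (A j γ * A k (τ l (σ j γ))) + A j (τ l γ) * A k (τ l (σ j γ))) := by
    simp only [mul_add, mul_sub, Finset.sum_add_distrib, Finset.sum_sub_distrib]
    congr 1
    · congr 1
      · rw [Finset.sum_comm]
        simp only [rowOp_apply, Finset.mul_sum, ← hA, ← hB', hB]
        refine Finset.sum_congr rfl fun j _ => ?_
        rw [Finset.sum_comm]
        exact Finset.sum_congr rfl fun l _ => Finset.sum_congr rfl fun k _ => by ring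
      · rw [Finset.sum_comm]
        simp only [rowOp_apply, Finset.mul_sum, ← hA, ← hB', hB]
        refine Finset.sum_congr rfl fun j _ => Finset.sum_congr rfl fun l _ =>
          Finset.sum_congr rfl fun k _ => ?_
        rw [hστ k l]
        ring
    · simp only [rowOp_apply, Finset.mul_sum, ← hA, ← hB']
      refine Finset.sum_congr rfl fun l _ => Finset.sum_congr rfl fun j _ =>
          Finset.sum_congr rfl fun k _ => ?_
      rw [hστ k l, hστ j l]
      ring
  rw [hsum]
  refine Finset.sum_eq_zero fun l _ => sum_sum_eq_zero_of_antisymm _ fun j k => ?_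
  rw [hσσ j k, ← mul_add, key, mul_zero]

/-- The coefficient A_j is affine in each y_l separately, so its second difference in one y_l
vanishes. For l ≠ m, with a and b the factors of A_j at y_l and y_m, (a + d)(b + d) - 2(a + d)b + ab
= d(y_m - y_l + d), which cancels a denominator and leaves d/(y_l - y_m) times a symmetric factor.
-/
theorem rowOp_serre_right [DecidableEq R] {x : J → X → ℂ} {y : R → X → ℂ} {z : Q → X → ℂ}
    {σ : J → X → X} {τ : R → X → X} {d : ℂ} (hσy : FixesRow σ y)
    (hσz : FixesRow σ z) (hτy : ShiftsRow τ y d) (hτx : FixesRow τ x) (hτz : FixesRow τ z)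
    (hττ : ∀ j k γ, τ k (τ j γ) = τ j (τ k γ)) (hστ : ∀ j l γ, τ l (σ j γ) = σ j (τ l γ))
    {γ : X} (h0 : ∀ j k, j ≠ k → y j γ - y k γ ≠ 0) (h1 : ∀ j k, j ≠ k → y j γ - y k γ ≠ d)
    (f : X → ℂ) :
    rowOp y z τ d (rowOp y z τ d (rowOp x y σ d f)) γ -
      2 * rowOp y z τ d (rowOp x y σ d (rowOp y z τ d f)) γ +
      rowOp x y σ d (rowOp y z τ d (rowOp y z τ d f)) γ = 0 := by
  have hB : ∀ l j γ, rowCoeff y z d l (σ j γ) = rowCoeff y z d l γ := fun l j γ =>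
    rowCoeff_congr (fun s => hσy j γ s) (fun r => hσz j γ r)
  have hτx' : ∀ l γ s, x s (τ l γ) = x s γ := hτx
  have hτy' : ∀ l γ s, y s (τ l γ) = y s γ - if s = l then d else 0 := hτy
  set A := rowCoeff x y d with hA
  set B := rowCoeff y z d with hB'
  have key : ∀ j l m,
      B l γ * B m (τ l γ) * (A j (τ m (τ l γ)) - 2 * A j (τ l γ) + A j γ) +
      B m γ * B l (τ m γ) * (A j (τ m (τ l γ)) - 2 * A j (τ m γ) + A j γ) = 0 := by
    intro j l m
    rcases eq_or_ne l m with rfl | hlm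
    · have e1 : ∀ γ, A j γ = _ := rowCoeff_eq_rest_mul x y d j l
      have e2 : ∀ γ, rowRest x y d (Finset.univ.erase l) (Finset.univ.erase j) j (τ l γ) =
          rowRest x y d (Finset.univ.erase l) (Finset.univ.erase j) j γ := fun γ =>
        rowRest_congr (hτx _ _ _) (fun _ _ => hτx _ _ _) (fun r hr => by
          rw [hτy, if_neg (Finset.ne_of_mem_erase hr), sub_zero])
      simp only [e1, e2, hτx', hτy', if_true]
      ring
    · have e1 : ∀ γ, A j γ = _ := rowCoeff_eq_rest_mul_mul x y d j hlm.symm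
      have e2 : ∀ k γ, k = l ∨ k = m →
          rowRest x y d ((Finset.univ.erase l).erase m) (Finset.univ.erase j) j (τ k γ) =
          rowRest x y d ((Finset.univ.erase l).erase m) (Finset.univ.erase j) j γ := fun k γ hk =>
        rowRest_congr (hτx _ _ _) (fun _ _ => hτx _ _ _) (fun r hr => by
          have h1 := Finset.ne_of_mem_erase hr
          have h2 := Finset.ne_of_mem_erase (Finset.mem_of_mem_erase hr)
          rw [hτy, if_neg (by rcases hk with rfl | rfl <;> assumption), sub_zero])
      have e3 : ∀ l m, m ≠ l → ∀ γ, B l γ = _ := fun l m h γ => rowCoeff_eq_rest_div z d h γ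
      have e4 : ∀ l m γ, m ≠ l →
          rowRest y z d Finset.univ ((Finset.univ.erase l).erase m) l (τ m γ) =
          rowRest y z d Finset.univ ((Finset.univ.erase l).erase m) l γ :=
        fun l m γ h => rowRest_congr (by rw [hτy, if_neg h.symm, sub_zero])
          (fun s hs => by rw [hτy, if_neg (Finset.ne_of_mem_erase hs), sub_zero])
          (fun _ _ => hτz _ _ _)
      simp only [e3 l m hlm.symm, e3 m l hlm, e4 l m _ hlm.symm, e4 m l _ hlm, e1,
        e2 l _ (Or.inl rfl), e2 m _ (Or.inr rfl), hτx', hτy', if_true, if_neg hlm,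
        if_neg hlm.symm, sub_zero]
      have n1 := h0 l m hlm
      have n2 := h0 m l hlm.symm
      have n3 : y m γ - (y l γ - d) ≠ 0 := fun h => h1 l m hlm (by linear_combination -h)
      have n4 : y l γ - (y m γ - d) ≠ 0 := fun h => h1 m l hlm.symm (by linear_combination -h)
      generalize rowRest y z d _ _ l γ = p
      generalize rowRest y z d _ _ m γ = q
      generalize rowRest x y d _ _ j γ = r
      field_simp
      ring
  have hsum : rowOp y z τ d (rowOp y z τ d (rowOp x y σ d f)) γ -
      2 * rowOp y z τ d (rowOp x y σ d (rowOp y z τ d f)) γ +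
      rowOp x y σ d (rowOp y z τ d (rowOp y z τ d f)) γ =
      ∑ j, ∑ l, ∑ m, f (σ j (τ m (τ l γ))) *
        (B l γ * B m (τ l γ) * (A j (τ m (τ l γ)) - 2 * A j (τ l γ) + A j γ)) := by
    simp only [mul_add, mul_sub, Finset.sum_add_distrib, Finset.sum_sub_distrib]
    congr 1
    · congr 1
      · rw [Finset.sum_comm]
        simp only [rowOp_apply, Finset.mul_sum, ← hA, ← hB']
        refine Finset.sum_congr rfl fun j _ => ?_
        rw [Finset.sum_comm]
        exact Finset.sum_congr rfl fun l _ => Finset.sum_congr rfl fun k _ => by ring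
      · rw [Finset.sum_comm]
        simp only [rowOp_apply, Finset.mul_sum, ← hA, ← hB', hB]
        refine Finset.sum_congr rfl fun j _ => Finset.sum_congr rfl fun l _ =>
          Finset.sum_congr rfl fun k _ => ?_
        rw [hστ l k]
        ring
    · simp only [rowOp_apply, Finset.mul_sum, ← hA, ← hB', hB]
      refine Finset.sum_congr rfl fun l _ => Finset.sum_congr rfl fun j _ =>
          Finset.sum_congr rfl fun k _ => ?_
      rw [hστ l j, hB, hστ l k]
      ring
  rw [hsum]
  refine Finset.sum_eq_zero fun j _ => sum_sum_eq_zero_of_antisymm _ fun l m => ?_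
  rw [hττ l m, ← mul_add]
  have := key j l m
  rw [hττ l m] at this
  rw [this, mul_zero]

/-! ### Lagrange interpolation and the commutator of the two operators of one row. -/

open Polynomial in
/-- Lagrange interpolation applied to the difference of two monic polynomials. -/
theorem sum_prod_sub_div_prod_sub {I K : Type*} [Fintype I] [DecidableEq I] [Fintype K]
    (hcard : Fintype.card K = Fintype.card I) {v : I → ℂ} (hv : Function.Injective v) (w : K → ℂ) :
    ∑ i, (∏ k, (v i - w k)) / ∏ j ∈ Finset.univ.erase i, (v i - v j) = ∑ i, v i - ∑ k, w k := by
  rcases isEmpty_or_nonempty I with hI | hI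
  · have : IsEmpty K := Fintype.card_eq_zero_iff.1 (hcard.trans Fintype.card_eq_zero)
    simp
  have hpos : 0 < Fintype.card I := Fintype.card_pos
  set P : ℂ[X] := ∏ k, (X - C (w k)) with hP
  set D : ℂ[X] := ∏ i, (X - C (v i)) with hD
  have mP : P.Monic := monic_prod_of_monic _ _ fun _ _ => monic_X_sub_C _
  have mD : D.Monic := monic_prod_of_monic _ _ fun _ _ => monic_X_sub_C _
  have dP : P.natDegree = Fintype.card I := by
    rw [hP, natDegree_prod_of_monic _ _ fun _ _ => monic_X_sub_C _]; simp [hcard]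
  have dD : D.natDegree = Fintype.card I := by
    rw [hD, natDegree_prod_of_monic _ _ fun _ _ => monic_X_sub_C _]; simp
  have hdeg : (P - D).degree < (Finset.univ : Finset I).card := by
    have := degree_sub_lt_left (p := P) (q := D)
      (by rw [degree_eq_natDegree mP.ne_zero, degree_eq_natDegree mD.ne_zero, dP, dD])
      mP.ne_zero (by rw [mP.leadingCoeff, mD.leadingCoeff])
    rwa [degree_eq_natDegree mP.ne_zero, dP] at this
  -- The leading terms of P and D cancel, so P - D is determined by its values at the nodes, where D
  -- vanishes. Its coefficient in degree |I| - 1 is the difference of the root sums.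
  have hcoeff := Lagrange.coeff_eq_sum (s := Finset.univ) (v := v) hv.injOn hdeg
  have cP : P.coeff (Fintype.card I - 1) = -∑ k, w k := by
    rw [← prod_X_sub_C_nextCoeff, ← hP, nextCoeff, if_neg (by omega), dP]
  have cD : D.coeff (Fintype.card I - 1) = -∑ i, v i := by
    rw [← prod_X_sub_C_nextCoeff, ← hD, nextCoeff, if_neg (by omega), dD]
  rw [Finset.card_univ, coeff_sub, cP, cD] at hcoeff
  rw [show ∑ i, v i - ∑ k, w k = -∑ k, w k - -∑ i, v i by ring, hcoeff]
  refine Finset.sum_congr rfl fun i _ => ?_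
  rw [eval_sub, hP, hD, eval_prod, eval_prod, Finset.prod_eq_zero (i := i) (Finset.mem_univ i)
    (by simp)]
  simp

/-- Both sums together are -d times one interpolation sum, with nodes x_j and x_j + d and roots y_r
+ d/2 and z_q + d/2. The partner node contributes the factor -d at x_j and d at x_j + d, whence the
difference of sums. The cardinality condition also makes the shifts by d drop out of the right side.
-/
theorem sum_prod_shift_sub_sum_prod_shift {d : ℂ} (hd : d ≠ 0) {x : J → ℂ} (y : R → ℂ) (z : Q → ℂ)
    (h0 : ∀ j k, j ≠ k → x j - x k ≠ 0) (h1 : ∀ j k, j ≠ k → x j - x k ≠ d)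
    (hcard : Fintype.card R + Fintype.card Q = 2 * Fintype.card J) :
    ∑ j, ((∏ r, (x j - y r - d / 2)) * ∏ q, (x j - z q - d / 2)) /
        ((∏ s ∈ Finset.univ.erase j, (x j - x s)) * ∏ s ∈ Finset.univ.erase j, (x j - d - x s)) -
      ∑ j, ((∏ r, (x j - y r + d / 2)) * ∏ q, (x j - z q + d / 2)) /
        ((∏ s ∈ Finset.univ.erase j, (x j - x s)) * ∏ s ∈ Finset.univ.erase j, (x j + d - x s)) =
      -d * (2 * ∑ j, x j - ∑ r, y r - ∑ q, z q) := by
  have hv : Function.Injective (Sum.elim x fun j => x j + d) := by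
    refine Function.Injective.sumElim (fun j k h => ?_) (fun j k h => ?_) (fun j k h => ?_)
    · by_contra hjk; exact h0 j k hjk (sub_eq_zero.2 h)
    · by_contra hjk; exact h0 j k hjk (sub_eq_zero.2 (add_right_cancel h))
    · rcases eq_or_ne j k with rfl | hjk
      · exact hd (by simpa using h)
      · exact h1 j k hjk (by rw [h]; ring)
  have key := sum_prod_sub_div_prod_sub (K := R ⊕ Q) (by simp [hcard, two_mul]) hv
    (Sum.elim (fun r => y r + d / 2) fun q => z q + d / 2)
  have el : ∀ j : J, (Finset.univ : Finset (J ⊕ J)).erase (Sum.inl j) =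
      (Finset.univ.erase j).disjSum Finset.univ := by
    intro j; ext (a | a) <;> simp
  have er : ∀ j : J, (Finset.univ : Finset (J ⊕ J)).erase (Sum.inr j) =
      Finset.univ.disjSum (Finset.univ.erase j) := by
    intro j; ext (a | a) <;> simp
  simp only [Fintype.sum_sum_type, Fintype.prod_sum_type, el, er, Finset.prod_disjSum,
    Sum.elim_inl, Sum.elim_inr, Finset.sum_add_distrib, Finset.sum_const, Finset.card_univ,
    nsmul_eq_mul] at key
  have hc : (Fintype.card R + Fintype.card Q : ℂ) = 2 * Fintype.card J := by exact_mod_cast hcard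
  rw [show -d * (2 * ∑ j, x j - ∑ r, y r - ∑ q, z q) = -d * (∑ j, x j + (∑ j, x j +
    Fintype.card J * d) - (∑ r, y r + Fintype.card R * (d / 2) + (∑ q, z q +
    Fintype.card Q * (d / 2)))) by linear_combination (d ^ 2 / 2) * (-hc), ← key, mul_add,
    sub_eq_add_neg, Finset.mul_sum, Finset.mul_sum, ← Finset.sum_neg_distrib]
  congr 1
  · refine Finset.sum_congr rfl fun j _ => ?_
    rw [← Finset.mul_prod_erase Finset.univ (fun s => x j - (x s + d)) (Finset.mem_univ j)]
    rw [show x j - (x j + d) = -d by ring]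
    simp only [← sub_sub, sub_right_comm _ _ d]
    rw [show (∏ s ∈ Finset.univ.erase j, (x j - x s)) * (-d * ∏ s ∈ Finset.univ.erase j,
      (x j - d - x s)) = -d * ((∏ s ∈ Finset.univ.erase j, (x j - x s)) *
      ∏ s ∈ Finset.univ.erase j, (x j - d - x s)) by ring, ← mul_div_assoc,
      mul_div_mul_left _ _ (neg_ne_zero.2 hd)]
  · refine Finset.sum_congr rfl fun j _ => ?_
    rw [← Finset.mul_prod_erase Finset.univ (fun s => x j + d - x s) (Finset.mem_univ j)]
    simp only [add_sub_add_right_eq_sub, add_sub_cancel_left]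
    rw [show d * (∏ s ∈ Finset.univ.erase j, (x j + d - x s)) * (∏ s ∈ Finset.univ.erase j,
      (x j - x s)) = d * ((∏ s ∈ Finset.univ.erase j, (x j - x s)) *
      ∏ s ∈ Finset.univ.erase j, (x j + d - x s)) by ring, ← mul_div_assoc, neg_mul, neg_div,
      mul_div_mul_left _ _ hd]
    congr 3 <;> exact Finset.prod_congr rfl fun _ _ => by ring

theorem rowOp_commutator {x : J → X → ℂ} {y : R → X → ℂ} {z : Q → X → ℂ}
    {σ τ : J → X → X} {d : ℂ} (hd : d ≠ 0) (hσx : ShiftsRow σ x d) (hσz : FixesRow σ z)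
    (hτx : ShiftsRow τ x (-d)) (hτy : FixesRow τ y)
    (hτσ : ∀ j γ, τ j (σ j γ) = γ) (hστ : ∀ j k γ, τ k (σ j γ) = σ j (τ k γ))
    (hcard : Fintype.card R + Fintype.card Q = 2 * Fintype.card J)
    {γ : X} (h0 : ∀ j k, j ≠ k → x j γ - x k γ ≠ 0) (h1 : ∀ j k, j ≠ k → x j γ - x k γ ≠ d)
    (f : X → ℂ) :
    rowOp x y σ d (rowOp x z τ (-d) f) γ - rowOp x z τ (-d) (rowOp x y σ d f) γ =
      -d * (2 * ∑ j, x j γ - ∑ r, y r γ - ∑ q, z q γ) * f γ := by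
  -- The two denominators joining x_j and x_k both change sign between the two orders, so the mixed
  -- terms agree.
  have off : ∀ j k, j ≠ k → rowCoeff x y d j γ * rowCoeff x z (-d) k (σ j γ) =
      rowCoeff x z (-d) k γ * rowCoeff x y d j (τ k γ) := by
    intro j k hjk
    rw [rowCoeff_eq_rest_div y d hjk.symm, rowCoeff_eq_rest_div y d hjk.symm,
      rowCoeff_eq_rest_div z (-d) hjk, rowCoeff_eq_rest_div z (-d) hjk,
      rowRest_congr (γ := γ) (γ' := σ j γ) (by rw [hσx, if_neg hjk.symm, sub_zero])
        (fun s hs => by rw [hσx, if_neg (Finset.ne_of_mem_erase hs), sub_zero])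
        (fun _ _ => hσz _ _ _),
      rowRest_congr (γ := γ) (γ' := τ k γ) (by rw [hτx, if_neg hjk, sub_zero])
        (fun s hs => by rw [hτx, if_neg (Finset.ne_of_mem_erase hs), sub_zero])
        (fun _ _ => hτy _ _ _),
      hσx, hσx, hτx, hτx, if_neg hjk.symm, if_pos rfl, if_neg hjk, if_pos rfl, sub_zero, sub_zero,
      show x k γ - (x j γ - d) = -(x j γ - (x k γ - -d)) by ring,
      show x k γ - x j γ = -(x j γ - x k γ) by ring, inv_neg, inv_neg]
    ring
  have hsum : rowOp x y σ d (rowOp x z τ (-d) f) γ - rowOp x z τ (-d) (rowOp x y σ d f) γ =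
      ∑ j, ∑ k, (rowCoeff x y d j γ * rowCoeff x z (-d) k (σ j γ) -
        rowCoeff x z (-d) k γ * rowCoeff x y d j (τ k γ)) * f (τ k (σ j γ)) := by
    simp only [sub_mul, Finset.sum_sub_distrib]
    congr 1
    · simp only [rowOp_apply, Finset.mul_sum, mul_assoc]
    · rw [Finset.sum_comm]
      simp only [rowOp_apply, Finset.mul_sum, mul_assoc, hστ]
  have hdiag : ∀ j, ∑ k, (rowCoeff x y d j γ * rowCoeff x z (-d) k (σ j γ) -
        rowCoeff x z (-d) k γ * rowCoeff x y d j (τ k γ)) * f (τ k (σ j γ)) =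
      (rowCoeff x y d j γ * rowCoeff x z (-d) j (σ j γ) -
        rowCoeff x z (-d) j γ * rowCoeff x y d j (τ j γ)) * f γ := by
    intro j
    rw [Finset.sum_eq_single j, hτσ]
    · intro k _ hk
      rw [off j k hk.symm, sub_self, zero_mul]
    · simp
  rw [hsum, Finset.sum_congr rfl fun j _ => hdiag j, ← Finset.sum_mul, Finset.sum_sub_distrib,
    ← sum_prod_shift_sub_sum_prod_shift hd (fun r => y r γ) (fun q => z q γ) h0 h1 hcard]
  have hσz' : ∀ j γ r, z r (σ j γ) = z r γ := hσz
  have hτy' : ∀ j γ r, y r (τ j γ) = y r γ := hτy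
  congr 2
  · refine Finset.sum_congr rfl fun j _ => ?_
    unfold rowCoeff
    rw [div_mul_div_comm, hσx j γ j, if_pos rfl]
    congr 2
    · exact Finset.prod_congr rfl fun q _ => by rw [hσz']; ring
    · exact Finset.prod_congr rfl fun s hs => by
        rw [hσx, if_neg (Finset.ne_of_mem_erase hs), sub_zero]
  · refine Finset.sum_congr rfl fun j _ => ?_
    unfold rowCoeff
    rw [div_mul_div_comm, hτx j γ j, if_pos rfl, mul_comm (∏ q, _) (∏ r, _)]
    refine congrArg₂ _ (congrArg₂ _ ?_ ?_) (congrArg₂ _ rfl ?_)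
    · exact Finset.prod_congr rfl fun q _ => by rw [hτy']; ring
    · exact Finset.prod_congr rfl fun q _ => by ring
    · exact Finset.prod_congr rfl fun s hs => by
        rw [hτx, if_neg (Finset.ne_of_mem_erase hs), sub_zero, sub_neg_eq_add]

end RowOperators

/-! ### Operators on functions and their action modulo generic equality. -/

section GenericOperators

variable {X : Type*} [NormedAddCommGroup X] [NormedSpace ℂ X]

theorem IsMeromorphic.mul {f₁ f₂ : X → ℂ}
    (m₁ : IsMeromorphic f₁) (m₂ : IsMeromorphic f₂) : IsMeromorphic (f₁ * f₂) := by
  intro p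
  obtain ⟨g₁, h₁, ag₁, ah₁, n₁, e₁⟩ := m₁ p
  obtain ⟨g₂, h₂, ag₂, ah₂, n₂, e₂⟩ := m₂ p
  refine ⟨fun z => g₁ z * g₂ z, fun z => h₁ z * h₂ z, ag₁.mul ag₂, ah₁.mul ah₂,
    not_eventually_mul_eq_zero ah₁ ah₂ n₁ n₂, ?_⟩
  filter_upwards [e₁, e₂] with z hz₁ hz₂ hz
  obtain ⟨k₁, k₂⟩ := mul_ne_zero_iff.1 hz
  rw [Pi.mul_apply, hz₁ k₁, hz₂ k₂, div_mul_div_comm]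

theorem IsMeromorphic.comp_add_right {f : X → ℂ} (m : IsMeromorphic f) (v : X) :
    IsMeromorphic fun γ => f (γ + v) := by
  intro p
  obtain ⟨g, h, ag, ah, n, e⟩ := m (p + v)
  have hv : AnalyticAt ℂ (fun γ : X => γ + v) p := analyticAt_id.add analyticAt_const
  have hmap : Filter.map (fun γ : X => γ + v) (𝓝 p) = 𝓝 (p + v) :=
    (Homeomorph.addRight v).map_nhds_eq p
  rw [← hmap] at n e
  exact ⟨fun γ => g (γ + v), fun γ => h (γ + v), AnalyticAt.fun_comp ag hv,
    AnalyticAt.fun_comp ah hv, n, e⟩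

theorem eventually_denseOpenFilter_iff {Y : Type*} [TopologicalSpace Y] {p : Y → Prop} :
    (∀ᶠ γ in denseOpenFilter Y, p γ) ↔ Dense (interior {γ | p γ}) := Iff.rfl

omit [NormedSpace ℂ X] in
theorem not_eventually_nhds_of_generic {h : X → ℂ} (hh : ∀ᶠ γ in denseOpenFilter X, h γ ≠ 0)
    (p : X) : ¬ ∀ᶠ z in 𝓝 p, h z = 0 := by
  intro h0
  have hd : Dense {γ | h γ ≠ 0} := (eventually_denseOpenFilter_iff.1 hh).mono interior_subset
  obtain ⟨U, hU, hUo, hpU⟩ := eventually_nhds_iff.1 h0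
  obtain ⟨z, hzU, hz⟩ := hd.inter_open_nonempty U hUo ⟨p, hpU⟩
  exact hz (hU z hzU)

theorem isMeromorphic_div {g h : X → ℂ} (hg : ∀ p, AnalyticAt ℂ g p) (ah : ∀ p, AnalyticAt ℂ h p)
    (hh : ∀ᶠ γ in denseOpenFilter X, h γ ≠ 0) : IsMeromorphic fun γ => g γ / h γ := fun p =>
  ⟨g, h, hg p, ah p, not_eventually_nhds_of_generic hh p, Filter.Eventually.of_forall fun _ _ => rfl⟩

theorem isMeromorphic_of_analytic {g : X → ℂ} (hg : ∀ p, AnalyticAt ℂ g p) : IsMeromorphic g := by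
  simpa using isMeromorphic_div (h := fun _ => 1) hg (fun _ => analyticAt_const) (by simp)

omit [NormedSpace ℂ X] in
theorem tendsto_add_right_denseOpenFilter (v : X) :
    Filter.Tendsto (fun γ : X => γ + v) (denseOpenFilter X) (denseOpenFilter X) := by
  intro s hs
  change Dense (interior ((fun γ : X => γ + v) ⁻¹' s))
  have := (Homeomorph.addRight v).preimage_interior s
  simp only [Homeomorph.coe_addRight] at this
  rw [← this]
  exact Dense.preimage hs (Homeomorph.addRight v).isOpenMap

/-- The operators on functions that act on meromorphic functions up to generic equality. -/
def genericOps (X : Type*) [NormedAddCommGroup X] [NormedSpace ℂ X] :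
    Subalgebra ℂ (Module.End ℂ (X → ℂ)) where
  carrier := {T | (∀ f, IsMeromorphic f → IsMeromorphic (T f)) ∧
    ∀ f g, f =ᶠ[denseOpenFilter X] g → T f =ᶠ[denseOpenFilter X] T g}
  mul_mem' hS hT := ⟨fun f hf => hS.1 _ (hT.1 f hf), fun f g hfg => hS.2 _ _ (hT.2 f g hfg)⟩
  add_mem' hS hT := ⟨fun f hf => (hS.1 f hf).add (hT.1 f hf),
    fun f g hfg => (hS.2 f g hfg).add (hT.2 f g hfg)⟩
  algebraMap_mem' c := ⟨fun _ hf => hf.const_smul c, fun _ _ hfg => hfg.const_smul c⟩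

theorem mulLeft_mem_genericOps {c : X → ℂ} (hc : IsMeromorphic c) :
    LinearMap.mulLeft ℂ c ∈ genericOps X :=
  ⟨fun _ hf => hc.mul hf, fun _ _ hfg => Filter.EventuallyEq.rfl.mul hfg⟩

theorem funLeft_add_mem_genericOps (v : X) :
    LinearMap.funLeft ℂ ℂ (fun γ : X => γ + v) ∈ genericOps X :=
  ⟨fun _ hf => hf.comp_add_right v, fun _ _ hfg =>
    Filter.EventuallyEq.comp_tendsto hfg (tendsto_add_right_denseOpenFilter v)⟩

theorem rowOp_mem_genericOps {J R : Type*} [Fintype J] [DecidableEq J] [Fintype R]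
    {x : J → X → ℂ} {y : R → X → ℂ} {d : ℂ} (v : J → X)
    (hc : ∀ j, IsMeromorphic (rowCoeff x y d j)) :
    rowOp x y (fun j γ => γ + v j) d ∈ genericOps X := by
  have : rowOp x y (fun j γ => γ + v j) d = ∑ j, LinearMap.mulLeft ℂ (rowCoeff x y d j) *
      LinearMap.funLeft ℂ ℂ (fun γ : X => γ + v j) := by
    ext f γ
    simp [rowOp_apply, LinearMap.funLeft]
  rw [this]
  exact sum_mem fun j _ => mul_mem (mulLeft_mem_genericOps (hc j)) (funLeft_add_mem_genericOps _)

/-- The action of a generic operator on the space of meromorphic functions. -/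
def genericEnd (T : genericOps X) : Module.End ℂ (MeromorphicSpace X) where
  toFun F := ⟨Filter.Germ.map' (T : Module.End ℂ (X → ℂ)) (fun f g => T.2.2 f g) F.1, by
    obtain ⟨_, f, hf, rfl⟩ := F
    exact ⟨_, T.2.1 f hf, rfl⟩⟩
  map_add' := by
    rintro ⟨_, f, hf, rfl⟩ ⟨_, g, hg, rfl⟩
    exact Subtype.ext (congrArg (fun u : X → ℂ => (u : GenericFun X))
      (map_add (T : Module.End ℂ (X → ℂ)) f g))
  map_smul' := by
    rintro c ⟨_, f, hf, rfl⟩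
    exact Subtype.ext (congrArg (fun u : X → ℂ => (u : GenericFun X))
      (map_smul (T : Module.End ℂ (X → ℂ)) c f))

theorem genericEnd_toSpace (T : genericOps X) {f : X → ℂ} (hf : IsMeromorphic f) :
    (genericEnd T hf.toSpace : GenericFun X) = ((T : Module.End ℂ (X → ℂ)) f : X → ℂ) := rfl

theorem linearMap_ext_toSpace {S T : Module.End ℂ (MeromorphicSpace X)}
    (h : ∀ (f : X → ℂ) (hf : IsMeromorphic f),
      (S hf.toSpace : GenericFun X) = (T hf.toSpace : GenericFun X)) : S = T := by
  refine LinearMap.ext ?_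
  rintro ⟨_, f, hf, rfl⟩
  exact Subtype.ext (h f hf)

/-- The action of the generic operators as a homomorphism of algebras. -/
def genericEndHom (X : Type*) [NormedAddCommGroup X] [NormedSpace ℂ X] :
    genericOps X →ₐ[ℂ] Module.End ℂ (MeromorphicSpace X) :=
  AlgHom.ofLinearMap
    { toFun := genericEnd
      map_add' := fun _ _ => linearMap_ext_toSpace fun _ _ => rfl
      map_smul' := fun _ _ => linearMap_ext_toSpace fun _ _ => rfl }
    (linearMap_ext_toSpace fun _ _ => rfl)
    (fun _ _ => linearMap_ext_toSpace fun _ _ => rfl)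

/-- This passage to M allows the rational identities to be checked off their poles only. -/
theorem genericEndHom_eq {S T : genericOps X}
    (h : ∀ f : X → ℂ, ∀ᶠ γ in denseOpenFilter X,
      (S : Module.End ℂ (X → ℂ)) f γ = (T : Module.End ℂ (X → ℂ)) f γ) :
    genericEndHom X S = genericEndHom X T :=
  linearMap_ext_toSpace fun f _ => Filter.Germ.coe_eq.2 (h f)

theorem genericEndHom_smul (c : ℂ) (T : genericOps X) :
    genericEndHom X (c • T) = c • genericEndHom X T :=
  linearMap_ext_toSpace fun _ _ => rfl

theorem genericEndHom_sub (S T : genericOps X) :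
    genericEndHom X (S - T) = genericEndHom X S - genericEndHom X T :=
  linearMap_ext_toSpace fun _ _ => rfl

theorem genericEndHom_commutator_eq {S T U : genericOps X}
    (h : ∀ f : X → ℂ, ∀ᶠ γ in denseOpenFilter X,
      (S : Module.End ℂ (X → ℂ)) ((T : Module.End ℂ (X → ℂ)) f) γ -
        (T : Module.End ℂ (X → ℂ)) ((S : Module.End ℂ (X → ℂ)) f) γ =
        (U : Module.End ℂ (X → ℂ)) f γ) :
    genericEndHom X S * genericEndHom X T =
      genericEndHom X T * genericEndHom X S + genericEndHom X U := by
  rw [← map_mul, ← map_mul, ← map_add]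
  exact genericEndHom_eq fun f => (h f).mono fun γ hγ => sub_eq_iff_eq_add'.1 hγ

theorem genericEndHom_serre {S T : genericOps X}
    (h : ∀ f : X → ℂ, ∀ᶠ γ in denseOpenFilter X,
      (S : Module.End ℂ (X → ℂ)) ((S : Module.End ℂ (X → ℂ)) ((T : Module.End ℂ (X → ℂ)) f)) γ -
        2 * (S : Module.End ℂ (X → ℂ)) ((T : Module.End ℂ (X → ℂ))
          ((S : Module.End ℂ (X → ℂ)) f)) γ +
        (T : Module.End ℂ (X → ℂ)) ((S : Module.End ℂ (X → ℂ))
          ((S : Module.End ℂ (X → ℂ)) f)) γ = 0) :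
    genericEndHom X S * (genericEndHom X S * genericEndHom X T) +
      genericEndHom X T * (genericEndHom X S * genericEndHom X S) =
      genericEndHom X S * (genericEndHom X T * genericEndHom X S) +
      genericEndHom X S * (genericEndHom X T * genericEndHom X S) := by
  simp only [← map_mul]
  rw [← map_add, ← map_add]
  refine genericEndHom_eq fun f => (h f).mono fun γ hγ => ?_
  simp only [Subalgebra.coe_add, Subalgebra.coe_mul, LinearMap.add_apply, Module.End.mul_apply,
    Pi.add_apply]
  linear_combination hγ

/-- A nonzero linear form is an open map, so the preimage of the dense set ℂ ∖ {c} is dense. -/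
theorem eventually_coord_sub_ne {ι : Type*} [Fintype ι] {a b : ι} (hab : a ≠ b) (c : ℂ) :
    ∀ᶠ γ in denseOpenFilter (ι → ℂ), γ a - γ b ≠ c := by
  classical
  let φ : (ι → ℂ) →L[ℂ] ℂ := ContinuousLinearMap.proj (R := ℂ) (φ := fun _ : ι => ℂ) a -
    ContinuousLinearMap.proj (R := ℂ) (φ := fun _ : ι => ℂ) b
  have hs : Function.Surjective φ := fun t => ⟨Pi.single a t, by simp [φ, hab.symm]⟩
  have ho : IsOpen (φ ⁻¹' {c}ᶜ) := isOpen_compl_singleton.preimage φ.continuous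
  rw [eventually_denseOpenFilter_iff]
  change Dense (interior (φ ⁻¹' {c}ᶜ))
  rw [ho.interior_eq]
  exact (dense_compl_singleton c).preimage (φ.isOpenMap hs)

end GenericOperators

/-! ### The Serre relations written out in an associative algebra. -/

section AssociativeChevalley

theorem isChevalleySystem_of_ring {A : Type*} [Ring A] {N : ℕ} {h e f : ℕ → A}
    (hh : ∀ i j, h i * h j = h j * h i)
    (he : ∀ i j, h i * e j = e j * h i +
      ((if i = j then 1 else 0) - (if i = j + 1 then 1 else 0) : ℤ) • e j)
    (hf : ∀ i j, h i * f j = f j * h i +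
      ((if i = j + 1 then 1 else 0) - (if i = j then 1 else 0) : ℤ) • f j)
    (ef : ∀ i, i + 1 < N → e i * f i = f i * e i + (h i - h (i + 1)))
    (ef_of_ne : ∀ i j, i ≠ j → e i * f j = f j * e i)
    (ee : ∀ i j, i + 1 < j → e i * e j = e j * e i)
    (ff : ∀ i j, i + 1 < j → f i * f j = f j * f i)
    (se : ∀ i j, (j = i + 1 ∨ i = j + 1) → e i * (e i * e j) + e j * (e i * e i) =
      e i * (e j * e i) + e i * (e j * e i))
    (sf : ∀ i j, (j = i + 1 ∨ i = j + 1) → f i * (f i * f j) + f j * (f i * f i) =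
      f i * (f j * f i) + f i * (f j * f i)) :
    IsChevalleySystem N h e f := by
  have serre : ∀ a b : A, a * (a * b) + b * (a * a) = a * (b * a) + a * (b * a) →
      ⁅a, ⁅a, b⁆⁆ = 0 := by
    intro a b hab
    rw [LieRing.of_associative_ring_bracket, LieRing.of_associative_ring_bracket, mul_sub, sub_mul,
      mul_assoc, mul_assoc, ← sub_eq_zero.2 hab]
    abel
  constructor
  · intro i j; rw [LieRing.of_associative_ring_bracket, hh, sub_self]
  · intro i j; rw [LieRing.of_associative_ring_bracket, he, add_sub_cancel_left]
  · intro i j; rw [LieRing.of_associative_ring_bracket, hf, add_sub_cancel_left]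
  · intro i hi; rw [LieRing.of_associative_ring_bracket, ef i hi, add_sub_cancel_left]
  · intro i j hij; rw [LieRing.of_associative_ring_bracket, ef_of_ne i j hij, sub_self]
  · intro i j hij; rw [LieRing.of_associative_ring_bracket, ee i j hij, sub_self]
  · intro i j hij; rw [LieRing.of_associative_ring_bracket, ff i j hij, sub_self]
  · exact fun i => serre _ _ (se _ _ (Or.inl rfl))
  · exact fun i => serre _ _ (se _ _ (Or.inr rfl))
  · exact fun i => serre _ _ (sf _ _ (Or.inl rfl))
  · exact fun i => serre _ _ (sf _ _ (Or.inr rfl))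

theorem serre_smul {M : Type*} [AddCommGroup M] [Module ℂ M] {a b : Module.End ℂ M}
    (hab : a * (a * b) + b * (a * a) = a * (b * a) + a * (b * a)) (c c' : ℂ) :
    (c • a) * ((c • a) * (c' • b)) + (c' • b) * ((c • a) * (c • a)) =
      (c • a) * ((c' • b) * (c • a)) + (c • a) * ((c' • b) * (c • a)) := by
  simp only [smul_mul_assoc, mul_smul_comm]
  have h := congrArg (fun t => (c * c * c') • t) hab
  simp only [smul_add] at h
  simp only [smul_smul]
  rwa [show c' * (c * c) = c * c * c' by ring, show c * (c * c') = c * c * c' by ring,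
    show c * (c' * c) = c * c * c' by ring]

end AssociativeChevalley

/-! ### The Gelfand–Zetlin operators as a Chevalley system. -/

section GelfandZetlin

variable {N : ℕ}

/-- The row `n` of a triangular array as a family of functions. -/
def gzRow (label : Fin N → ℂ) (n : ℕ) (hn : n ≤ N) (j : Fin n) (γ : GZArray N) : ℂ :=
  gzEntry label γ n hn j

/-- The translation of the entry `j` of the row `n` by `c`. -/
def gzMove (n : ℕ) (hn : n < N) (c : ℂ) (j : Fin n) (γ : GZArray N) : GZArray N :=
  γ + Pi.single ⟨⟨n, hn⟩, j⟩ c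

theorem gzMove_comm (n : ℕ) (hn : n < N) (c : ℂ) (m : ℕ) (hm : m < N) (c' : ℂ) (j : Fin n)
    (k : Fin m) (γ : GZArray N) :
    gzMove m hm c' k (gzMove n hn c j γ) = gzMove n hn c j (gzMove m hm c' k γ) :=
  add_right_comm _ _ _

theorem gzRow_of_lt (label : Fin N → ℂ) {n : ℕ} (hn : n < N) (j : Fin n) (γ : GZArray N) :
    gzRow label n hn.le j γ = γ ⟨⟨n, hn⟩, j⟩ := by
  simp [gzRow, gzEntry, hn]

theorem shiftsRow_gzMove (label : Fin N → ℂ) (n : ℕ) (hn : n < N) (d : ℂ) :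
    ShiftsRow (gzMove n hn (-d)) (gzRow label n hn.le) d := by
  intro j γ k
  rw [gzRow_of_lt label hn, gzRow_of_lt label hn, gzMove, Pi.add_apply, sub_eq_add_neg]
  congr 1
  split_ifs with h
  · subst h; simp
  · rw [Pi.single_eq_of_ne (by simpa using h), neg_zero]

theorem fixesRow_gzMove (label : Fin N → ℂ) {n m : ℕ} (hn : n < N) (hm : m ≤ N) (hnm : m ≠ n)
    (c : ℂ) : FixesRow (gzMove n hn c) (gzRow label m hm) := by
  intro j γ k
  rcases hm.lt_or_eq with hm' | rfl
  · rw [gzRow_of_lt label hm', gzRow_of_lt label hm', gzMove, Pi.add_apply,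
      Pi.single_eq_of_ne (fun h => hnm (congrArg (fun s => (s.1 : ℕ)) h)), add_zero]
  · simp [gzRow, gzEntry]

theorem analyticAt_gzRow (label : Fin N → ℂ) {n : ℕ} (hn : n ≤ N) (j : Fin n) (p : GZArray N) :
    AnalyticAt ℂ (gzRow label n hn j) p := by
  rcases hn.lt_or_eq with hn' | rfl
  · rw [show gzRow label n hn j = fun γ => γ ⟨⟨n, hn'⟩, j⟩ from funext (gzRow_of_lt label hn' j)]
    exact (ContinuousLinearMap.proj (R := ℂ) (φ := fun _ : (Σ n : Fin N, Fin (n : ℕ)) => ℂ)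
      ⟨⟨n, hn'⟩, j⟩).analyticAt p
  · rw [show gzRow label n hn j = fun _ => label (Fin.castLE hn j) from
      funext fun γ => by simp [gzRow, gzEntry]]
    exact analyticAt_const

theorem eventually_gzRow_sub_ne (label : Fin N → ℂ) {n : ℕ} (hn : n < N) (c : ℂ) :
    ∀ᶠ γ in denseOpenFilter (GZArray N), ∀ j k, j ≠ k →
      gzRow label n hn.le j γ - gzRow label n hn.le k γ ≠ c := by
  have h : ∀ j k : Fin n, ∀ᶠ γ in denseOpenFilter (GZArray N), j ≠ k →
      gzRow label n hn.le j γ - gzRow label n hn.le k γ ≠ c := by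
    intro j k
    by_cases hjk : j = k
    · exact Filter.Eventually.of_forall fun γ h => absurd hjk h
    · have hne : (⟨⟨n, hn⟩, j⟩ : Σ n : Fin N, Fin (n : ℕ)) ≠ ⟨⟨n, hn⟩, k⟩ :=
        fun h => hjk (by simpa using h)
      refine (eventually_coord_sub_ne hne c).mono fun γ hγ _ => ?_
      rwa [gzRow_of_lt label hn, gzRow_of_lt label hn]
  exact Filter.eventually_all.2 fun j => Filter.eventually_all.2 fun k => h j k

theorem isMeromorphic_rowCoeff_gzRow (label : Fin N → ℂ) {n m : ℕ} (hn : n < N) (hm : m ≤ N)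
    (d : ℂ) (j : Fin n) :
    IsMeromorphic (rowCoeff (gzRow label n hn.le) (gzRow label m hm) d j) := by
  refine isMeromorphic_div
    (fun p => Finset.analyticAt_fun_prod _ fun r _ =>
      ((analyticAt_gzRow label _ j p).sub (analyticAt_gzRow label _ r p)).sub analyticAt_const)
    (fun p => Finset.analyticAt_fun_prod _ fun s _ =>
      (analyticAt_gzRow label _ j p).sub (analyticAt_gzRow label _ s p)) ?_
  filter_upwards [eventually_gzRow_sub_ne label hn 0] with γ hγ
  exact Finset.prod_ne_zero_iff.2 fun s hs => hγ j s (Finset.ne_of_mem_erase hs).symm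

/-- The difference operator of the row `n` coupled to the row `m`. -/
noncomputable def gzOp (label : Fin N → ℂ) (n : ℕ) (hn : n < N) (m : ℕ) (hm : m ≤ N) (d : ℂ) :
    genericOps (GZArray N) :=
  ⟨rowOp (gzRow label n hn.le) (gzRow label m hm) (gzMove n hn (-d)) d,
    rowOp_mem_genericOps _ (isMeromorphic_rowCoeff_gzRow label hn hm d)⟩

/-- The operator `gzDiag` as a generic operator. -/
noncomputable def gzDiagOp (hbar : ℂ) (label : Fin N → ℂ) (k : ℕ) (hk : k + 1 ≤ N) :
    genericOps (GZArray N) :=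
  ⟨LinearMap.mulLeft ℂ fun γ => 1 / (Complex.I * hbar) *
    (∑ j, gzRow label (k + 1) hk j γ - ∑ j, gzRow label k (Nat.le_of_succ_le hk) j γ),
    mulLeft_mem_genericOps (isMeromorphic_of_analytic fun p => analyticAt_const.mul
      ((Finset.analyticAt_fun_sum _ fun j _ => analyticAt_gzRow label _ j p).sub
        (Finset.analyticAt_fun_sum _ fun j _ => analyticAt_gzRow label _ j p)))⟩

theorem gzOp_commute (label : Fin N → ℂ) {n m p q : ℕ} (hn : n < N) (hm : m ≤ N) (hp : p < N)
    (hq : q ≤ N) (d d' : ℂ) (hnp : n ≠ p) (hmp : m ≠ p) (hnq : n ≠ q) :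
    genericEndHom _ (gzOp label n hn m hm d) * genericEndHom _ (gzOp label p hp q hq d') =
      genericEndHom _ (gzOp label p hp q hq d') * genericEndHom _ (gzOp label n hn m hm d) := by
  rw [← map_mul, ← map_mul]
  refine genericEndHom_eq fun f => Filter.Eventually.of_forall fun γ => ?_
  exact rowOp_comm_of_fixes (fixesRow_gzMove label hn _ hnp.symm _)
    (fixesRow_gzMove label hn _ hnq.symm _) (fixesRow_gzMove label hp _ hnp _)
    (fixesRow_gzMove label hp _ hmp _) (fun _ _ _ => gzMove_comm _ _ _ _ _ _ _ _ _) f γ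

theorem gzOp_commute_opposite (label : Fin N → ℂ) {n m : ℕ} (hn : n < N) (hm : m < N) (d : ℂ)
    (hnm : n ≠ m) :
    genericEndHom _ (gzOp label n hn m hm.le d) * genericEndHom _ (gzOp label m hm n hn.le (-d)) =
      genericEndHom _ (gzOp label m hm n hn.le (-d)) *
        genericEndHom _ (gzOp label n hn m hm.le d) := by
  rw [← map_mul, ← map_mul]
  refine genericEndHom_eq fun f => Filter.Eventually.of_forall fun γ => ?_
  exact rowOp_comm_opposite (shiftsRow_gzMove label n hn d) (fixesRow_gzMove label hn _ hnm.symm _)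
    (shiftsRow_gzMove label m hm (-d)) (fixesRow_gzMove label hm _ hnm _)
    (fun _ _ _ => gzMove_comm _ _ _ _ _ _ _ _ _) f γ

theorem gzOp_serre_left (label : Fin N → ℂ) {n m p : ℕ} (hn : n < N) (hm : m < N) (hp : p ≤ N)
    (d : ℂ) (hnm : n ≠ m) (hnp : n ≠ p) :
    genericEndHom _ (gzOp label n hn m hm.le d) * (genericEndHom _ (gzOp label n hn m hm.le d) *
      genericEndHom _ (gzOp label m hm p hp d)) + genericEndHom _ (gzOp label m hm p hp d) *
      (genericEndHom _ (gzOp label n hn m hm.le d) * genericEndHom _ (gzOp label n hn m hm.le d)) =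
    genericEndHom _ (gzOp label n hn m hm.le d) * (genericEndHom _ (gzOp label m hm p hp d) *
      genericEndHom _ (gzOp label n hn m hm.le d)) +
    genericEndHom _ (gzOp label n hn m hm.le d) * (genericEndHom _ (gzOp label m hm p hp d) *
      genericEndHom _ (gzOp label n hn m hm.le d)) := by
  refine genericEndHom_serre fun f => ?_
  filter_upwards [eventually_gzRow_sub_ne label hn 0, eventually_gzRow_sub_ne label hn d]
    with γ h0 h1
  exact rowOp_serre_left (shiftsRow_gzMove label n hn d) (fixesRow_gzMove label hn _ hnm.symm _)
    (fixesRow_gzMove label hn _ hnp.symm _) (shiftsRow_gzMove label m hm d)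
    (fixesRow_gzMove label hm _ hnm _) (fun _ _ _ => gzMove_comm _ _ _ _ _ _ _ _ _)
    (fun _ _ _ => gzMove_comm _ _ _ _ _ _ _ _ _) h0 h1 f

theorem gzOp_serre_right (label : Fin N → ℂ) {n m p : ℕ} (hn : n < N) (hm : m < N) (hp : p ≤ N)
    (d : ℂ) (hnm : n ≠ m) (hnp : n ≠ p) (hmp : m ≠ p) :
    genericEndHom _ (gzOp label m hm p hp d) * (genericEndHom _ (gzOp label m hm p hp d) *
      genericEndHom _ (gzOp label n hn m hm.le d)) + genericEndHom _ (gzOp label n hn m hm.le d) *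
      (genericEndHom _ (gzOp label m hm p hp d) * genericEndHom _ (gzOp label m hm p hp d)) =
    genericEndHom _ (gzOp label m hm p hp d) * (genericEndHom _ (gzOp label n hn m hm.le d) *
      genericEndHom _ (gzOp label m hm p hp d)) +
    genericEndHom _ (gzOp label m hm p hp d) * (genericEndHom _ (gzOp label n hn m hm.le d) *
      genericEndHom _ (gzOp label m hm p hp d)) := by
  refine genericEndHom_serre fun f => ?_
  filter_upwards [eventually_gzRow_sub_ne label hm 0, eventually_gzRow_sub_ne label hm d]
    with γ h0 h1
  exact rowOp_serre_right (fixesRow_gzMove label hn _ hnm.symm _)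
    (fixesRow_gzMove label hn _ hnp.symm _) (shiftsRow_gzMove label m hm d)
    (fixesRow_gzMove label hm _ hnm _) (fixesRow_gzMove label hm _ hmp.symm _)
    (fun _ _ _ => gzMove_comm _ _ _ _ _ _ _ _ _)
    (fun _ _ _ => gzMove_comm _ _ _ _ _ _ _ _ _) h0 h1 f

theorem gzDiagOp_commute (hbar : ℂ) (label : Fin N → ℂ) {k l : ℕ} (hk : k + 1 ≤ N)
    (hl : l + 1 ≤ N) :
    genericEndHom _ (gzDiagOp hbar label k hk) * genericEndHom _ (gzDiagOp hbar label l hl) =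
      genericEndHom _ (gzDiagOp hbar label l hl) * genericEndHom _ (gzDiagOp hbar label k hk) := by
  rw [← map_mul, ← map_mul]
  refine genericEndHom_eq fun f => Filter.Eventually.of_forall fun γ => ?_
  exact mul_left_comm _ _ _

theorem sum_gzRow_gzMove (label : Fin N → ℂ) {n m : ℕ} (hn : n < N) (hm : m ≤ N) (d : ℂ)
    (j : Fin n) (γ : GZArray N) :
    ∑ r, gzRow label m hm r (gzMove n hn (-d) j γ) =
      ∑ r, gzRow label m hm r γ - if m = n then d else 0 := by
  split_ifs with h
  · subst h
    simp [shiftsRow_gzMove label m hn d j γ _, Finset.sum_sub_distrib]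
  · rw [sub_zero]
    exact Finset.sum_congr rfl fun r _ => fixesRow_gzMove label hn hm h _ j γ r

/-- The diagonal operator multiplies by a difference of row sums, and the shift by -s·iℏ changes the
sum of row n alone. The sign s = 1 serves the raising operators and s = -1 the lowering ones. -/
theorem gzDiagOp_mul_gzOp {hbar : ℂ} (hbar_ne : hbar ≠ 0) (label : Fin N → ℂ) {k n m : ℕ}
    (hk : k + 1 ≤ N) (hn : n < N) (hm : m ≤ N) (s c : ℂ) :
    genericEndHom _ (gzDiagOp hbar label k hk) *
        c • genericEndHom _ (gzOp label n hn m hm (s * (Complex.I * hbar))) =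
      c • genericEndHom _ (gzOp label n hn m hm (s * (Complex.I * hbar))) *
        genericEndHom _ (gzDiagOp hbar label k hk) +
      (s * ((if k + 1 = n then 1 else 0) - (if k = n then 1 else 0))) •
        c • genericEndHom _ (gzOp label n hn m hm (s * (Complex.I * hbar))) := by
  simp only [← genericEndHom_smul]
  refine genericEndHom_commutator_eq fun f => Filter.Eventually.of_forall fun γ => ?_
  have hI : Complex.I * hbar ≠ 0 := mul_ne_zero Complex.I_ne_zero hbar_ne
  change (1 / (Complex.I * hbar) * (∑ j, gzRow label (k + 1) hk j γ -
      ∑ j, gzRow label k (Nat.le_of_succ_le hk) j γ)) * (c * ∑ j, _ * _) -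
    c * ∑ j, _ * ((1 / (Complex.I * hbar) * (∑ r, gzRow label (k + 1) hk r
      (gzMove n hn (-(s * (Complex.I * hbar))) j γ) -
      ∑ r, gzRow label k (Nat.le_of_succ_le hk) r (gzMove n hn (-(s * (Complex.I * hbar))) j γ))) *
      _) = _ * (c * ∑ j, _ * _)
  simp only [sum_gzRow_gzMove, Finset.mul_sum, ← Finset.sum_sub_distrib]
  refine Finset.sum_congr rfl fun j _ => ?_
  split_ifs <;> field_simp <;> ring

theorem gzOp_commutator {hbar : ℂ} (hbar_ne : hbar ≠ 0) (label : Fin N → ℂ) {k : ℕ}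
    (hk : k + 1 < N) :
    (-(1 / (Complex.I * hbar))) • genericEndHom _ (gzOp label (k + 1) hk (k + 2) hk
      (Complex.I * hbar)) * (1 / (Complex.I * hbar)) • genericEndHom _ (gzOp label (k + 1) hk k
      (Nat.le_of_succ_le hk.le) (-(Complex.I * hbar))) =
    (1 / (Complex.I * hbar)) • genericEndHom _ (gzOp label (k + 1) hk k
      (Nat.le_of_succ_le hk.le) (-(Complex.I * hbar))) * (-(1 / (Complex.I * hbar))) •
      genericEndHom _ (gzOp label (k + 1) hk (k + 2) hk (Complex.I * hbar)) +
    (genericEndHom _ (gzDiagOp hbar label k hk.le) -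
      genericEndHom _ (gzDiagOp hbar label (k + 1) hk)) := by
  simp only [← genericEndHom_smul, ← genericEndHom_sub]
  refine genericEndHom_commutator_eq fun f => ?_
  have hI : Complex.I * hbar ≠ 0 := mul_ne_zero Complex.I_ne_zero hbar_ne
  filter_upwards [eventually_gzRow_sub_ne label hk 0,
    eventually_gzRow_sub_ne label hk (Complex.I * hbar)] with γ h0 h1
  set A : Module.End ℂ (GZArray N → ℂ) :=
    (gzOp label (k + 1) hk (k + 2) hk (Complex.I * hbar)).1 with hA
  set B : Module.End ℂ (GZArray N → ℂ) :=
    (gzOp label (k + 1) hk k (Nat.le_of_succ_le hk.le) (-(Complex.I * hbar))).1 with hB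
  -- Row k + 1 is coupled to rows of k + 2 and k entries, together twice k + 1. The resulting
  -- 2S_{k+1} - S_{k+2} - S_k, with S the row sums, is iℏ times the difference of the two diagonal
  -- multipliers.
  have key : A (B f) γ - B (A f) γ = _ := rowOp_commutator hI (shiftsRow_gzMove label (k + 1) hk _)
    (fixesRow_gzMove label hk (Nat.le_of_succ_le hk.le) (by lia) _)
    (shiftsRow_gzMove label (k + 1) hk _)
    (fixesRow_gzMove label hk (m := k + 2) hk (by lia) _)
    (fun j γ => by simp [gzMove, add_assoc, ← Pi.single_add])
    (fun _ _ => gzMove_comm _ _ _ _ _ _ _ _) (by simp; lia) h0 h1 f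
  have hL : ∀ (c : ℂ) (T : genericOps (GZArray N)) (g : GZArray N → ℂ) (γ : GZArray N),
    ((c • T : genericOps (GZArray N)) : Module.End ℂ (GZArray N → ℂ)) g γ =
      c * (T : Module.End ℂ (GZArray N → ℂ)) g γ := fun _ _ _ _ => rfl
  have hL' : ∀ (c : ℂ) (T : genericOps (GZArray N)) (g : GZArray N → ℂ),
    ((c • T : genericOps (GZArray N)) : Module.End ℂ (GZArray N → ℂ)) g =
      c • (T : Module.End ℂ (GZArray N → ℂ)) g := fun _ _ _ => rfl
  have hS : ∀ (S T : genericOps (GZArray N)) (g : GZArray N → ℂ) (γ : GZArray N),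
    ((S - T : genericOps (GZArray N)) : Module.End ℂ (GZArray N → ℂ)) g γ =
      (S : Module.End ℂ (GZArray N → ℂ)) g γ - (T : Module.End ℂ (GZArray N → ℂ)) g γ :=
    fun _ _ _ _ => rfl
  have hD : ∀ (l : ℕ) (hl : l + 1 ≤ N), (gzDiagOp hbar label l hl :
    Module.End ℂ (GZArray N → ℂ)) f γ = 1 / (Complex.I * hbar) * (∑ j, gzRow label (l + 1) hl j γ -
      ∑ j, gzRow label l (Nat.le_of_succ_le hl) j γ) * f γ := fun _ _ => rfl
  rw [hL, hL, hL', hL', map_smul, map_smul, hS, hD, hD, Pi.smul_apply, Pi.smul_apply, smul_eq_mul,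
    smul_eq_mul]
  rw [← hA, ← hB, show -(1 / (Complex.I * hbar)) * (1 / (Complex.I * hbar) * A (B f) γ) -
    1 / (Complex.I * hbar) * (-(1 / (Complex.I * hbar)) * B (A f) γ) =
    -(1 / (Complex.I * hbar)) * (1 / (Complex.I * hbar)) * (A (B f) γ - B (A f) γ) by ring, key]
  field_simp
  ring

/-- The operator `E n n` for `n = k + 1` on the meromorphic functions, and `0` out of range. -/
noncomputable def gzDiagEnd (hbar : ℂ) (label : Fin N → ℂ) (k : ℕ) :
    Module.End ℂ (MeromorphicSpace (GZArray N)) :=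
  if hk : k + 1 ≤ N then genericEndHom _ (gzDiagOp hbar label k hk) else 0

/-- The operator `E n (n + 1)` for `n = k + 1` on the meromorphic functions, and `0` out of
range. -/
noncomputable def gzRaiseEnd (hbar : ℂ) (label : Fin N → ℂ) (k : ℕ) :
    Module.End ℂ (MeromorphicSpace (GZArray N)) :=
  if hk : k + 1 < N then (-(1 / (Complex.I * hbar))) •
    genericEndHom _ (gzOp label (k + 1) hk (k + 2) hk (Complex.I * hbar)) else 0

/-- The operator `E (n + 1) n` for `n = k + 1` on the meromorphic functions, and `0` out of
range. -/
noncomputable def gzLowerEnd (hbar : ℂ) (label : Fin N → ℂ) (k : ℕ) :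
    Module.End ℂ (MeromorphicSpace (GZArray N)) :=
  if hk : k + 1 < N then (1 / (Complex.I * hbar)) •
    genericEndHom _ (gzOp label (k + 1) hk k (Nat.le_of_succ_le hk.le) (-(Complex.I * hbar))) else 0

theorem smul_mul_smul_comm_of_commute {M : Type*} [AddCommGroup M] [Module ℂ M]
    {a b : Module.End ℂ M}
    (hab : a * b = b * a) (c c' : ℂ) : (c • a) * (c' • b) = (c' • b) * (c • a) :=
  ((show Commute a b from hab).smul_left c).smul_right c'

theorem intCast_smul_end {M : Type*} [AddCommGroup M] [Module ℂ M] (a : Module.End ℂ M) (z : ℤ) :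
    (z : ℂ) • a = z • a :=
  Int.cast_smul_eq_zsmul ℂ z a

theorem isChevalleySystem_gz {hbar : ℂ} (hbar_ne : hbar ≠ 0) (label : Fin N → ℂ) :
    IsChevalleySystem N (gzDiagEnd hbar label) (gzRaiseEnd hbar label) (gzLowerEnd hbar label) := by
  apply isChevalleySystem_of_ring
  · intro i j
    unfold gzDiagEnd
    split_ifs with hi hj hj
    · exact gzDiagOp_commute hbar label hi hj
    all_goals simp
  · intro i j
    by_cases hj : j + 1 < N
    · by_cases hi : i + 1 ≤ N
      · have key := gzDiagOp_mul_gzOp hbar_ne label hi hj (m := j + 2) hj 1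
          (-(1 / (Complex.I * hbar)))
        rw [one_mul, one_mul] at key
        simp only [gzDiagEnd, gzRaiseEnd, dif_pos hj, dif_pos hi]
        rw [key, show ((if i + 1 = j + 1 then 1 else 0) - (if i = j + 1 then 1 else 0) : ℂ) =
          (((if i = j then 1 else 0) - (if i = j + 1 then 1 else 0) : ℤ) : ℂ) by
          simp]
        exact congrArg _ (intCast_smul_end _ _)
      · simp only [gzDiagEnd, gzRaiseEnd, dif_pos hj, dif_neg hi, if_neg (by lia : ¬ i = j),
          if_neg (by lia : ¬ i = j + 1)]
        simp
    · simp [gzRaiseEnd, hj]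
  · intro i j
    by_cases hj : j + 1 < N
    · by_cases hi : i + 1 ≤ N
      · have key := gzDiagOp_mul_gzOp hbar_ne label hi hj (m := j)
          (Nat.le_of_succ_le hj.le) (-1) (1 / (Complex.I * hbar))
        rw [neg_one_mul, neg_one_mul, neg_sub] at key
        simp only [gzDiagEnd, gzLowerEnd, dif_pos hj, dif_pos hi]
        rw [key, show ((if i = j + 1 then 1 else 0) - (if i + 1 = j + 1 then 1 else 0) : ℂ) =
          (((if i = j + 1 then 1 else 0) - (if i = j then 1 else 0) : ℤ) : ℂ) by
          simp]
        exact congrArg _ (intCast_smul_end _ _)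
      · simp only [gzDiagEnd, gzLowerEnd, dif_pos hj, dif_neg hi, if_neg (by lia : ¬ i = j),
          if_neg (by lia : ¬ i = j + 1)]
        simp
    · simp [gzLowerEnd, hj]
  · intro i hi
    simp only [gzDiagEnd, gzRaiseEnd, gzLowerEnd, dif_pos hi, dif_pos hi.le,
      dif_pos (Nat.succ_le_of_lt hi)]
    exact gzOp_commutator hbar_ne label hi
  · intro i j hij
    unfold gzRaiseEnd gzLowerEnd
    split_ifs with hi hj hj
    · refine smul_mul_smul_comm_of_commute ?_ _ _
      -- Only for j = i + 1 do the operators interact: each then moves the row to which the other is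
      -- coupled.
      by_cases hji : j = i + 1
      · subst hji
        exact gzOp_commute_opposite label hi hj _ (by lia)
      · exact gzOp_commute label hi hi hj _ _ _ (by lia) (by lia) (by lia)
    all_goals simp
  · intro i j hij
    unfold gzRaiseEnd
    split_ifs with hi hj hj
    · exact smul_mul_smul_comm_of_commute
        (gzOp_commute label hi hi hj hj _ _ (by lia) (by lia) (by lia)) _ _
    all_goals simp
  · intro i j hij
    unfold gzLowerEnd
    split_ifs with hi hj hj
    · exact smul_mul_smul_comm_of_commute
        (gzOp_commute label (m := i) (q := j) hi _ hj _ _ _ (by lia) (by lia) (by lia)) _ _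
    all_goals simp
  · intro i j hij
    unfold gzRaiseEnd
    split_ifs with hi hj hj
    -- For the raising operators the smaller index is the row x of the abstract relations; for the
    -- lowering operators, coupled downwards, it is the larger one, so left and right change places.
    · refine serre_smul ?_ _ _
      rcases hij with rfl | rfl
      · exact gzOp_serre_left label hi hj hj _ (by lia) (by lia)
      · exact gzOp_serre_right label hj hi hi _ (by lia) (by lia) (by lia)
    all_goals simp
  · intro i j hij
    unfold gzLowerEnd
    split_ifs with hi hj hj
    · refine serre_smul ?_ _ _
      rcases hij with rfl | rfl
      · exact gzOp_serre_right label hj hi _ _ (by lia) (by lia) (by lia)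
      · exact gzOp_serre_left label hi hj _ _ (by lia) (by lia)
    all_goals simp

theorem gzDiagEnd_toSpace (hbar : ℂ) (label : Fin N → ℂ) {k : ℕ} (hk : k < N)
    {f : GZArray N → ℂ} (hf : IsMeromorphic f) :
    (gzDiagEnd hbar label k hf.toSpace : GenericFun (GZArray N)) =
      (gzDiag hbar label k hk f : GenericFun (GZArray N)) := by
  rw [gzDiagEnd, dif_pos (Nat.succ_le_of_lt hk)]
  rfl

theorem gzRaiseEnd_toSpace (hbar : ℂ) (label : Fin N → ℂ) {k : ℕ} (hk : k + 1 < N)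
    {f : GZArray N → ℂ} (hf : IsMeromorphic f) :
    (gzRaiseEnd hbar label k hf.toSpace : GenericFun (GZArray N)) =
      (gzRaise hbar label k hk f : GenericFun (GZArray N)) := by
  rw [gzRaiseEnd, dif_pos hk]
  rfl

theorem gzLowerEnd_toSpace (hbar : ℂ) (label : Fin N → ℂ) {k : ℕ} (hk : k + 1 < N)
    {f : GZArray N → ℂ} (hf : IsMeromorphic f) :
    (gzLowerEnd hbar label k hf.toSpace : GenericFun (GZArray N)) =
      (gzLower hbar label k hk f : GenericFun (GZArray N)) := by
  rw [gzLowerEnd, dif_pos hk, ← genericEndHom_smul]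
  refine (genericEnd_toSpace _ hf).trans (congrArg _ (funext fun γ => ?_))
  change 1 / (Complex.I * hbar) * ∑ j, rowCoeff (gzRow label (k + 1) hk.le)
    (gzRow label k (Nat.le_of_succ_le hk.le)) (-(Complex.I * hbar)) j γ *
    f (gzMove (k + 1) hk (- -(Complex.I * hbar)) j γ) = _
  unfold gzLower
  congr 1
  refine Finset.sum_congr rfl fun j _ => ?_
  simp only [rowCoeff, neg_div, sub_neg_eq_add, neg_neg, gzMove, gzShift, gzRow]

end GelfandZetlin

/-! ### Existence and uniqueness of the representation. -/

theorem proposition2p1 (N : ℕ) (hbar : ℂ) (hbar_ne : hbar ≠ 0) (label : Fin N → ℂ) :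
    ∃! ρ : Matrix (Fin N) (Fin N) ℂ →ₗ⁅ℂ⁆ Module.End ℂ (MeromorphicSpace (GZArray N)),
      ∀ (f : GZArray N → ℂ) (hf : IsMeromorphic f),
        (∀ (k : ℕ) (hk : k < N),
          (ρ (Matrix.single ⟨k, hk⟩ ⟨k, hk⟩ 1) hf.toSpace : GenericFun (GZArray N)) =
            (gzDiag hbar label k hk f : GenericFun (GZArray N))) ∧
        (∀ (k : ℕ) (hk : k + 1 < N),
          (ρ (Matrix.single ⟨k, Nat.lt_of_succ_lt hk⟩ ⟨k + 1, hk⟩ 1) hf.toSpace : GenericFun (GZArray N)) =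
            (gzRaise hbar label k hk f : GenericFun (GZArray N))) ∧
        (∀ (k : ℕ) (hk : k + 1 < N),
          (ρ (Matrix.single ⟨k + 1, hk⟩ ⟨k, Nat.lt_of_succ_lt hk⟩ 1) hf.toSpace : GenericFun (GZArray N)) =
            (gzLower hbar label k hk f : GenericFun (GZArray N))) := by
  -- Needed for the chain of three generators, where an element equal to its negative must vanish.
  have : IsAddTorsionFree (Module.End ℂ (MeromorphicSpace (GZArray N))) :=
    .of_isTorsionFree ℂ _
  have H := isChevalleySystem_gz hbar_ne label
  refine ⟨H.lieHom, fun f hf => ⟨fun k hk => ?_, fun k hk => ?_, fun k hk => ?_⟩, fun ρ hρ => ?_⟩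
  · rw [H.lieHom_diag hk, gzDiagEnd_toSpace hbar label hk hf]
  · rw [H.lieHom_raise hk, gzRaiseEnd_toSpace hbar label hk hf]
  · rw [H.lieHom_lower hk, gzLowerEnd_toSpace hbar label hk hf]
  · have htop : lieHomEqLocus ρ H.lieHom = ⊤ := by
      refine lieSubalgebra_eq_top_of_single_mem _ (fun k hk => ?_) (fun k hk => ?_)
        (fun k hk => ?_)
      · refine linearMap_ext_toSpace fun f hf => ?_
        rw [(hρ f hf).1 k hk, H.lieHom_diag hk, gzDiagEnd_toSpace hbar label hk hf]
      · refine linearMap_ext_toSpace fun f hf => ?_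
        rw [(hρ f hf).2.1 k hk, H.lieHom_raise hk, gzRaiseEnd_toSpace hbar label hk hf]
      · refine linearMap_ext_toSpace fun f hf => ?_
        rw [(hρ f hf).2.2 k hk, H.lieHom_lower hk, gzLowerEnd_toSpace hbar label hk hf]
    ext1 A
    exact (htop ▸ LieSubalgebra.mem_top A : A ∈ lieHomEqLocus ρ H.lieHom)
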